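/- Let $A\in\mathbb R^{n_s\times n_s}$ be Hurwitz (every complex eigenvalue has negative real part), $B\in\mathbb R^{n_s\times n_a}$, and let $\underline\xi,\overline\xi\in\mathbb R^{n_a\times n_s}$. Put $c_{ij}=\tfrac12(\underline\xi_{ij}+\overline\xi_{ij})$, $\overline c_{ij}=\overline\xi_{ij}-c_{ij}$ and $W=I_{n_a}\otimes 1_{1\times n_s}$, where vectors $q=(q_{ij})\in\mathbb R^{n_an_s}$ are indexed by $i\in[n_a]$, $j\in[n_s]$, so that $(Wq)_i=\sum_j q_{ij}$. For $q\in L_2([0,\infty);\mathbb R^{n_an_s})$ let $x=Gq$ be the state response of $\dot x=Ax+BWq$, $x(0)=0$, i.e. $(Gq)(t)=\int_0^t e^{(t-s)A}BWq(s)\,ds$, and let $\hat G(\mathrm j\omega)=(\mathrm j\omega I-A)^{-1}BW$. For signals $x,q$ put $$\phi_{ij}(x,q)=(\overline c_{ij}^2-c_{ij}^2)\|x_j\|^2+2c_{ij}\langle q_{ij},x_j\rangle-\|q_{ij}\|^2$$ with the norm and inner product of $L_2[0,\infty)$. For $\lambda\in\mathbb R^{n_a\times n_s}$ let $M(\lambda;\xi)$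 be the symmetric matrix of the quadratic form $(x,q)\mapsto\sum_{i,j}\lambda_{ij}\big((\overline c_{ij}^2-c_{ij}^2)x_j^2+2c_{ij}q_{ij}x_j-q_{ij}^2\big)$ on $\mathbb R^{n_s}\times\mathbb R^{n_an_s}$. For a symmetric $P$, $\lambda\ge0$ (entrywise) and $\gamma>0$, let $\mathrm{SDP}(P,\lambda,\gamma,\xi)$ be the condition $$\begin{bmatrix}O & S\\ S^\top & -\gamma I\end{bmatrix}\prec0,\qquad O=\begin{bmatrix}A^\top P+PA & PBW\\ W^\top B^\top P & 0\end{bmatrix}+\frac1\gamma\begin{bmatrix}I&0\\0&0\end{bmatrix}+M(\lambda;\xi),\qquad S=\begin{bmatrix}PB\\0\end{bmatrix}.$$ Consider the condition (C) there exist $\lambda_{ij}\ge0$ and $\epsilon>0$ such that $\sum_{i,j}\lambda_{ij}\phi_{ij}(Gq,q)\le-\epsilon\|q\|^2$ for all $q\in L_2([0,\infty);\mathbb R^{n_an_s})$. Then $Gq\in L_2$ for every $q\in L_2$, and: 1. If $c_{ij}^2\le\overline c_{ij}^2$ for all $i,j$ (for $\underline\xi_{ij}\le\overline\xi_{ij}$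 this says $\underline\xi_{ij}\le0\le\overline\xi_{ij}$), then there exist $P=P^\top\succeq0$, $\lambda\ge0$ and $\gamma>0$ such that $\mathrm{SDP}(P,\lambda,\gamma,\xi)$ holds if and only if (C) holds. 2. For arbitrary $\underline\xi,\overline\xi$, there exist $P=P^\top$ (not necessarily positive semidefinite), $\lambda\ge0$ and $\gamma>0$ such that $\mathrm{SDP}(P,\lambda,\gamma,\xi)$ holds if and only if (C) holds. 3. For every fixed $\lambda\ge0$, the inequality in (C) holds for some $\epsilon>0$ and all $q\in L_2([0,\infty);\mathbb R^{n_an_s})$ if and only if the frequency-domain inequality $$\begin{bmatrix}\hat G\\ I\end{bmatrix}^*M(\lambda;\xi)\begin{bmatrix}\hat G\\ I\end{bmatrix}\prec0$$ holds uniformly in the frequency, i.e. for some $\epsilon>0$ we have $\begin{bmatrix}\hat G(\mathrm j\omega)\\ I\end{bmatrix}^*M(\lambda;\xi)\begin{bmatrix}\hat G(\mathrm j\omega)\\ I\end{bmatrix}\preceq-\epsilon I$ for all $\omega\in\mathbb R$. -/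

import Mathlib

open MeasureTheory Matrix
open scoped ComplexOrder

noncomputable section

namespace SmoothMargin

/-- A square real matrix is Hurwitz if every complex eigenvalue has negative real part. -/
def IsHurwitz {n : ℕ} (A : Matrix (Fin n) (Fin n) ℝ) : Prop :=
  ∀ μ : ℂ, μ ∈ spectrum ℂ (A.map Complex.ofReal) → μ.re < 0

/-- `X ≺ 0`: the (symmetric) matrix `X` is negative definite. -/
def NegDef {ι : Type*} (X : Matrix ι ι ℝ) : Prop := (-X).PosDef

/-- The matrix `W = I_m ⊗ 1_{1×n}`, so that `(W q)_i = ∑_j q_ij`. -/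
def W (m n : ℕ) : Matrix (Fin m) (Fin m × Fin n) ℝ :=
  Matrix.of fun i k => if i = k.1 then 1 else 0

/-- The centre `c_ij = (lo_ij + hi_ij) / 2` of the interval `[lo_ij, hi_ij]`. -/
def center {m n : ℕ} (lo hi : Fin m → Fin n → ℝ) (i : Fin m) (j : Fin n) : ℝ :=
  (lo i j + hi i j) / 2

/-- The radius `hi_ij - c_ij` of the interval `[lo_ij, hi_ij]`. -/
def radius {m n : ℕ} (lo hi : Fin m → Fin n → ℝ) (i : Fin m) (j : Fin n) : ℝ :=
  hi i j - center lo hi i j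

/-- The off-diagonal block of `M(lam; lo, hi)`. -/
def U {m n : ℕ} (lam lo hi : Fin m → Fin n → ℝ) : Matrix (Fin n) (Fin m × Fin n) ℝ :=
  Matrix.of fun j k => if j = k.2 then lam k.1 k.2 * center lo hi k.1 k.2 else 0

/-- The multiplier matrix `M(lam; lo, hi)`, the matrix of the quadratic form
`(x, q) ↦ ∑_ij lam_ij ((cbar_ij² - c_ij²) x_j² + 2 c_ij q_ij x_j - q_ij²)`. -/
def M {m n : ℕ} (lam lo hi : Fin m → Fin n → ℝ) :
    Matrix (Fin n ⊕ (Fin m × Fin n)) (Fin n ⊕ (Fin m × Fin n)) ℝ :=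
  Matrix.fromBlocks
    (Matrix.diagonal fun j =>
      ∑ i, lam i j * ((radius lo hi i j) ^ 2 - (center lo hi i j) ^ 2))
    (U lam lo hi)
    (U lam lo hi)ᵀ
    (Matrix.diagonal fun k => -lam k.1 k.2)

/-- The upper left block `O(P, lam, xi)` of the SDP matrix. -/
def blockO {m n : ℕ} (A : Matrix (Fin n) (Fin n) ℝ) (B : Matrix (Fin n) (Fin m) ℝ)
    (lo hi : Fin m → Fin n → ℝ) (P : Matrix (Fin n) (Fin n) ℝ) (lam : Fin m → Fin n → ℝ)
    (γ : ℝ) : Matrix (Fin n ⊕ (Fin m × Fin n)) (Fin n ⊕ (Fin m × Fin n)) ℝ :=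
  Matrix.fromBlocks (Aᵀ * P + P * A) (P * B * W m n) ((W m n)ᵀ * Bᵀ * P) 0
    + (1 / γ) • Matrix.fromBlocks 1 0 0 0
    + M lam lo hi

/-- The upper right block `S(P)` of the SDP matrix. -/
def blockS {m n : ℕ} (B : Matrix (Fin n) (Fin m) ℝ) (P : Matrix (Fin n) (Fin n) ℝ) :
    Matrix (Fin n ⊕ (Fin m × Fin n)) (Fin m) ℝ :=
  Matrix.fromRows (P * B) 0

/-- The matrix whose negative definiteness is the condition `SDP(P, lam, γ, xi)`. -/
def sdpMatrix {m n : ℕ} (A : Matrix (Fin n) (Fin n) ℝ) (B : Matrix (Fin n) (Fin m) ℝ)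
    (lo hi : Fin m → Fin n → ℝ) (P : Matrix (Fin n) (Fin n) ℝ) (lam : Fin m → Fin n → ℝ)
    (γ : ℝ) :
    Matrix ((Fin n ⊕ (Fin m × Fin n)) ⊕ Fin m) ((Fin n ⊕ (Fin m × Fin n)) ⊕ Fin m) ℝ :=
  Matrix.fromBlocks (blockO A B lo hi P lam γ) (blockS B P) (blockS B P)ᵀ
    (-(γ • (1 : Matrix (Fin m) (Fin m) ℝ)))

/-- Square integrable signals on `[0, ∞)` with values in `ℝ^ι`. -/
def IsL2 {ι : Type*} (q : ℝ → ι → ℝ) : Prop :=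
  ∀ k, MemLp (fun t => q t k) 2 (volume.restrict (Set.Ici 0))

/-- The inner product of two scalar signals on `[0, ∞)`. -/
def sigInner (f g : ℝ → ℝ) : ℝ := ∫ t in Set.Ici (0 : ℝ), f t * g t

/-- The squared norm `‖q‖²` of a vector-valued signal on `[0, ∞)`. -/
def sigNormSq {ι : Type*} [Fintype ι] (q : ℝ → ι → ℝ) : ℝ :=
  ∑ k, sigInner (fun t => q t k) (fun t => q t k)

/-- The LTI operator `G : q ↦ x` of the system `x' = A x + B W q`, `x(0) = 0`, with output `x`,
that is, `x(t) = ∫_0^t exp((t-s)A) B W q(s) ds`. -/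
def G {m n : ℕ} (A : Matrix (Fin n) (Fin n) ℝ) (B : Matrix (Fin n) (Fin m) ℝ)
    (q : ℝ → Fin m × Fin n → ℝ) (t : ℝ) : Fin n → ℝ :=
  ∫ s in (0 : ℝ)..t, NormedSpace.exp ((t - s) • A) *ᵥ ((B * W m n) *ᵥ q s)

/-- `φ_ij(x, q) = (cbar_ij² - c_ij²) ‖x_j‖² + 2 c_ij ⟨q_ij, x_j⟩ - ‖q_ij‖²` for signals. -/
def phi {m n : ℕ} (lo hi : Fin m → Fin n → ℝ) (i : Fin m) (j : Fin n)
    (x : ℝ → Fin n → ℝ) (q : ℝ → Fin m × Fin n → ℝ) : ℝ :=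
  ((radius lo hi i j) ^ 2 - (center lo hi i j) ^ 2)
      * sigInner (fun t => x t j) (fun t => x t j)
    + 2 * center lo hi i j * sigInner (fun t => q t (i, j)) (fun t => x t j)
    - sigInner (fun t => q t (i, j)) (fun t => q t (i, j))

/-- The frequency response `Ĝ(jω) = (jω I - A)⁻¹ B W`. -/
def Ghat {m n : ℕ} (A : Matrix (Fin n) (Fin n) ℝ) (B : Matrix (Fin n) (Fin m) ℝ) (ω : ℝ) :
    Matrix (Fin n) (Fin m × Fin n) ℂ :=
  ((Complex.I * (ω : ℂ)) • (1 : Matrix (Fin n) (Fin n) ℂ) - A.map Complex.ofReal)⁻¹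
    * (B * W m n).map Complex.ofReal

/-- The matrix `[Ĝ(jω); I]* M(lam; lo, hi) [Ĝ(jω); I]`. -/
def freqForm {m n : ℕ} (A : Matrix (Fin n) (Fin n) ℝ) (B : Matrix (Fin n) (Fin m) ℝ)
    (lo hi lam : Fin m → Fin n → ℝ) (ω : ℝ) :
    Matrix (Fin m × Fin n) (Fin m × Fin n) ℂ :=
  (Matrix.fromRows (Ghat A B ω) (1 : Matrix (Fin m × Fin n) (Fin m × Fin n) ℂ))ᴴ
    * (M lam lo hi).map Complex.ofReal
    * Matrix.fromRows (Ghat A B ω) (1 : Matrix (Fin m × Fin n) (Fin m × Fin n) ℂ)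

/-- The condition that for some `ε > 0`, `∑_ij lam_ij φ_ij(G q, q) ≤ -ε ‖q‖²` for all signals `q`. -/
def MultiplierCond {m n : ℕ} (A : Matrix (Fin n) (Fin n) ℝ) (B : Matrix (Fin n) (Fin m) ℝ)
    (lo hi lam : Fin m → Fin n → ℝ) : Prop :=
  ∃ ε : ℝ, 0 < ε ∧ ∀ q : ℝ → Fin m × Fin n → ℝ, IsL2 q →
    ∑ i, ∑ j, lam i j * phi lo hi i j (G A B q) q ≤ -ε * sigNormSq q

/-- The frequency-domain inequality `[Ĝ; I]* M(lam; lo, hi) [Ĝ; I] ≺ 0`, as an operator inequality,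
that is, uniformly in the frequency: for some `ε > 0` the value at every `jω` is `⪯ -ε I`. -/
def FreqCond {m n : ℕ} (A : Matrix (Fin n) (Fin n) ℝ) (B : Matrix (Fin n) (Fin m) ℝ)
    (lo hi lam : Fin m → Fin n → ℝ) : Prop :=
  ∃ ε : ℝ, 0 < ε ∧ ∀ ω : ℝ,
    (-((ε : ℂ) • (1 : Matrix (Fin m × Fin n) (Fin m × Fin n) ℂ))
      - freqForm A B lo hi lam ω).PosSemidef

end SmoothMargin

end

open Filter Topology

namespace SmoothMargin

/-! ### Bilinear forms and weighted Young inequalities. -/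

section Bilinear

variable {α β : Type*} [Fintype α] [Fintype β]

/-! For each fixed multiplier `lam`, all the conditions are tied to the strict KYP inequality
`StorageIneq`: a symmetric `P` with 2xᵀP(Ax + BWq) + (x,q)ᵀM(x,q) < 0 off the origin. The SDP gives
it by putting the last block variable to zero; conversely, strictness leaves a margin, and a large γ
absorbs both the 1/γ term and the coupling PB (`StorageIneq.exists_negDef`). The rest is a cycle
through `MultiplierCond` and the frequency inequality `FreqNeg`.

From storage to time domain: integrate the inequality along x = Gq. The term xᵀPx vanishes at both
ends because A is Hurwitz, so no sign of `P` is needed (`IsTrajectory.integral_energy`).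

From time to frequency domain: test with damped sinusoids of exponent -σ + jω. Adding the real and
imaginary parts removes the oscillation, and the energy is of order 1/σ, while the deviation from
steady state has bounded energy as σ → 0 (`freq_le_of_time_le`).

From frequency to storage (`FreqNeg.exists_storage`): if no `P` exists, separation of convex sets
gives finitely many w_k = (x_k, u_k) with y_k = Ax_k + bu_k, ∑(y_k x_kᵀ + x_k y_kᵀ) = 0 and ∑
w_kᵀΘw_k ≥ 0. The first identity says that Y + X and Y - X have equal Gram matrices, so Y + X = (Y -
X)U with U unitary. Diagonalizing U replaces the w_k by complex combinations with y + x = d(y - x),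
|d| = 1, that is, y = jωx or x = 0. The frequency inequality, together with its limit at infinity,
makes every nonzero term negative, while the sum is unitarily invariant: a contradiction.

When c² ≤ c̄², the form M is nonnegative at q = 0, so the storage inequality contains a Lyapunov
inequality, which forces P ⪰ 0. -/

lemma dotProduct_mulVec_symm {P : Matrix α α ℝ} (hP : P.IsSymm) (x y : α → ℝ) :
    x ⬝ᵥ P *ᵥ y = y ⬝ᵥ P *ᵥ x := by
  rw [dotProduct_mulVec, ← mulVec_transpose, hP.eq, dotProduct_comm]

lemma dotProduct_self_nonneg_real (x : α → ℝ) : 0 ≤ x ⬝ᵥ x :=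
  Finset.sum_nonneg fun i _ => mul_self_nonneg (x i)

lemma dotProduct_self_pos_real {x : α → ℝ} (hx : x ≠ 0) : 0 < x ⬝ᵥ x :=
  (dotProduct_self_nonneg_real x).lt_of_ne fun h => hx (dotProduct_self_eq_zero.mp h.symm)

lemma mulVec_dotProduct_self_le (Θ : Matrix α β ℝ) (v : β → ℝ) :
    (Θ *ᵥ v) ⬝ᵥ (Θ *ᵥ v) ≤ (∑ i, ∑ j, Θ i j ^ 2) * (v ⬝ᵥ v) := by
  rw [Finset.sum_mul]
  refine Finset.sum_le_sum fun i _ => ?_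
  have := Finset.sum_mul_sq_le_sq_mul_sq Finset.univ (Θ i) v
  simpa [mulVec, dotProduct, ← sq] using this

lemma abs_dotProduct_le (δ : ℝ) (hδ : 0 < δ) (a c : α → ℝ) :
    |a ⬝ᵥ c| ≤ δ * (a ⬝ᵥ a) + 1 / δ * (c ⬝ᵥ c) := by
  simp only [dotProduct, Finset.mul_sum, ← Finset.sum_add_distrib]
  refine (Finset.abs_sum_le_sum_abs _ _).trans (Finset.sum_le_sum fun i _ => ?_)
  have h1 : δ * (a i * a i) + 1 / δ * (c i * c i) - 2 * (|a i| * |c i|)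
      = 1 / δ * (δ * |a i| - |c i|) ^ 2 := by
    rw [← abs_mul_abs_self (a i), ← abs_mul_abs_self (c i)]
    field_simp
    ring
  have h2 : 0 ≤ 1 / δ * (δ * |a i| - |c i|) ^ 2 := by positivity
  rw [abs_mul]
  have : 0 ≤ |a i| * |c i| := by positivity
  linarith

/-- Young's inequality with weight δ. The constant does not depend on δ, so δ can be tuned or sent
to zero later. -/
lemma exists_bilinear_bound (Θ : Matrix α β ℝ) :
    ∃ K : ℝ, 0 ≤ K ∧ ∀ δ : ℝ, 0 < δ → ∀ a v,
      |a ⬝ᵥ Θ *ᵥ v| ≤ δ * (a ⬝ᵥ a) + K / δ * (v ⬝ᵥ v) := by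
  refine ⟨∑ i, ∑ j, Θ i j ^ 2, by positivity, fun δ hδ a v => ?_⟩
  refine (abs_dotProduct_le δ hδ a _).trans ?_
  have := mulVec_dotProduct_self_le Θ v
  have h : 1 / δ * ((Θ *ᵥ v) ⬝ᵥ (Θ *ᵥ v)) ≤ 1 / δ * ((∑ i, ∑ j, Θ i j ^ 2) * (v ⬝ᵥ v)) := by
    gcongr
  calc _ ≤ _ := add_le_add le_rfl h
    _ = _ := by ring

end Bilinear

/-! ### Hurwitz matrices, the Cayley transform and Lyapunov functions. -/

section Stability

variable {n : ℕ} {A : Matrix (Fin n) (Fin n) ℝ}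

lemma IsHurwitz.isUnit_sub (hA : IsHurwitz A) {s : ℂ} (hs : 0 ≤ s.re) :
    IsUnit (s • (1 : Matrix (Fin n) (Fin n) ℂ) - A.map Complex.ofReal) := by
  by_contra h
  have : s ∈ spectrum ℂ (A.map Complex.ofReal) := by
    rw [spectrum.mem_iff, Algebra.algebraMap_eq_smul_one]
    exact h
  exact absurd (hA s this) (not_lt.mpr hs)

lemma IsHurwitz.isUnit_sub_one (hA : IsHurwitz A) : IsUnit (A - 1) := by
  have h := hA.isUnit_sub (s := 1) (by simp)
  rw [Matrix.isUnit_iff_isUnit_det] at h ⊢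
  have e : ((1 : ℂ) • (1 : Matrix (Fin n) (Fin n) ℂ) - A.map Complex.ofReal)
      = -((A - 1).map Complex.ofReal) := by
    ext i j; by_cases hij : i = j <;> simp [hij]
  rw [e, det_neg] at h
  have e2 : ((A - 1).map Complex.ofReal).det = ((A - 1).det : ℂ) :=
    (RingHom.map_det Complex.ofRealHom (A - 1)).symm
  rw [e2] at h
  rw [isUnit_iff_ne_zero] at h ⊢
  intro h0
  exact h (by simp [h0])

/-- The Cayley transform of a matrix. -/
noncomputable def cayley (A : Matrix (Fin n) (Fin n) ℝ) : Matrix (Fin n) (Fin n) ℝ := (A + 1) * (A - 1)⁻¹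

/-- This turns rates into differences: with y = Az - z, C the Cayley transform and P symmetric,
(Cy)ᵀP(Cy) - yᵀPy = 4zᵀPAz. -/
lemma IsHurwitz.cayley_mulVec (hA : IsHurwitz A) (z : Fin n → ℝ) :
    cayley A *ᵥ (A *ᵥ z - z) = A *ᵥ z + z := by
  have h := (Matrix.isUnit_iff_isUnit_det _).mp hA.isUnit_sub_one
  have : A *ᵥ z - z = (A - 1) *ᵥ z := by simp [sub_mulVec]
  rw [this, mulVec_mulVec, cayley, Matrix.nonsing_inv_mul_cancel_right _ _ h]
  simp [add_mulVec]

lemma IsHurwitz.exists_sub_eq (hA : IsHurwitz A) (y : Fin n → ℝ) : ∃ z, A *ᵥ z - z = y := by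
  have h := (Matrix.isUnit_iff_isUnit_det _).mp hA.isUnit_sub_one
  refine ⟨(A - 1)⁻¹ *ᵥ y, ?_⟩
  have : A *ᵥ ((A - 1)⁻¹ *ᵥ y) - (A - 1)⁻¹ *ᵥ y = (A - 1) *ᵥ ((A - 1)⁻¹ *ᵥ y) := by
    rw [sub_mulVec, one_mulVec]
  rw [this, mulVec_mulVec, Matrix.mul_nonsing_inv _ h, one_mulVec]

lemma exists_mulVec_eq_smul_of_mem_spectrum {ι : Type*} [Fintype ι] [DecidableEq ι]
    {X : Matrix ι ι ℂ} {μ : ℂ} (h : μ ∈ spectrum ℂ X) : ∃ v, v ≠ 0 ∧ X *ᵥ v = μ • v := by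
  rw [← Matrix.spectrum_toLin', ← Module.End.hasEigenvalue_iff_mem_spectrum] at h
  obtain ⟨v, hv⟩ := h.exists_hasEigenvector
  exact ⟨v, hv.2, by simpa using hv.apply_eq_smul⟩

lemma mem_spectrum_of_mulVec_eq_smul {ι : Type*} [Fintype ι] [DecidableEq ι]
    {X : Matrix ι ι ℂ} {μ : ℂ} {v : ι → ℂ} (hv : v ≠ 0) (h : X *ᵥ v = μ • v) :
    μ ∈ spectrum ℂ X := by
  rw [← Matrix.spectrum_toLin', ← Module.End.hasEigenvalue_iff_mem_spectrum]
  exact Module.End.hasEigenvalue_of_hasEigenvector (x := v)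
    ⟨by simpa [Module.End.mem_eigenspace_iff] using h, hv⟩

/-- An eigenvector Az - z for μ makes z an eigenvector of A for (μ+1)/(μ-1), whose real part is
(|μ|² - 1)/|μ - 1|². -/
lemma IsHurwitz.norm_lt_one_of_mem_spectrum_cayley (hA : IsHurwitz A) {μ : ℂ}
    (hμ : μ ∈ spectrum ℂ ((cayley A).map Complex.ofReal)) : ‖μ‖ < 1 := by
  obtain ⟨y, hy0, hy⟩ := exists_mulVec_eq_smul_of_mem_spectrum hμ
  have h := (Matrix.isUnit_iff_isUnit_det _).mp hA.isUnit_sub_one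
  have hc : (cayley A).map Complex.ofReal * (A.map Complex.ofReal - 1)
      = A.map Complex.ofReal + 1 := by
    have e : cayley A * (A - 1) = A + 1 := Matrix.nonsing_inv_mul_cancel_right _ _ h
    have := congrArg (Complex.ofRealHom.mapMatrix) e
    simp only [map_mul, map_sub, map_add, map_one] at this
    exact this
  have hs : ∃ z, A.map Complex.ofReal *ᵥ z - z = y := by
    have hu := (Matrix.isUnit_iff_isUnit_det _).mp (hA.isUnit_sub (s := 1) (by simp))
    set R := (1 : ℂ) • (1 : Matrix (Fin n) (Fin n) ℂ) - A.map Complex.ofReal with hR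
    refine ⟨-(R⁻¹ *ᵥ y), ?_⟩
    have : ∀ p, A.map Complex.ofReal *ᵥ -p - -p = R *ᵥ p := fun p => by
      rw [hR, sub_mulVec, smul_mulVec, one_mulVec, one_smul, mulVec_neg, sub_neg_eq_add, add_comm,
        ← sub_eq_add_neg]
    rw [this, mulVec_mulVec, Matrix.mul_nonsing_inv _ hu, one_mulVec]
  obtain ⟨z, hz⟩ := hs
  have hz' : A.map Complex.ofReal *ᵥ z + z = μ • (A.map Complex.ofReal *ᵥ z - z) := by
    have e1 : A.map Complex.ofReal *ᵥ z - z = (A.map Complex.ofReal - 1) *ᵥ z := by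
      simp [sub_mulVec]
    rw [hz, ← hy, ← hz, e1, mulVec_mulVec, hc]
    simp [add_mulVec]
  have hz0 : z ≠ 0 := by
    rintro rfl
    exact hy0 (by rw [← hz]; simp)
  have hμ1 : μ ≠ 1 := by
    rintro rfl
    apply hz0
    rw [one_smul] at hz'
    have : (2 : ℂ) • z = 0 := by
      rw [two_smul]
      linear_combination (exp := 1) hz'
    simpa using this
  have hsub : μ - 1 ≠ 0 := sub_ne_zero.mpr hμ1
  have heig : A.map Complex.ofReal *ᵥ z = ((μ + 1) / (μ - 1)) • z := by
    have h1 : (μ - 1) • (A.map Complex.ofReal *ᵥ z) = (μ + 1) • z := by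
      rw [smul_sub] at hz'
      rw [sub_smul, add_smul, one_smul, one_smul]
      linear_combination (exp := 1) -hz'
    rw [div_eq_inv_mul, mul_smul, ← h1, smul_smul, inv_mul_cancel₀ hsub, one_smul]
  have hre := hA _ (mem_spectrum_of_mulVec_eq_smul hz0 heig)
  have hns : 0 < Complex.normSq (μ - 1) := Complex.normSq_pos.mpr hsub
  rw [Complex.div_re, ← add_div, div_lt_iff₀ hns, zero_mul] at hre
  simp only [Complex.add_re, Complex.one_re, Complex.sub_re, Complex.add_im, Complex.one_im,
    Complex.sub_im] at hre
  have : ‖μ‖ ^ 2 < 1 := by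
    rw [← Complex.normSq_eq_norm_sq, Complex.normSq_apply]
    nlinarith
  nlinarith [norm_nonneg μ]

-- Gelfand's formula: ‖Xᵏ‖^(1/k) is eventually below some r < 1.
attribute [local instance] Matrix.linftyOpNormedRing Matrix.linftyOpNormedAlgebra in
lemma tendsto_pow_of_forall_mem_spectrum {X : Matrix (Fin n) (Fin n) ℂ}
    (h : ∀ μ ∈ spectrum ℂ X, ‖μ‖ < 1) : Tendsto (fun k => X ^ k) atTop (𝓝 0) := by
  rcases Nat.eq_zero_or_pos n with rfl | hn
  · exact tendsto_const_nhds.congr fun k => Subsingleton.elim _ _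
  have : Nonempty (Fin n) := ⟨⟨0, hn⟩⟩
  have hρ : spectralRadius ℂ X < ((1 : NNReal) : ENNReal) :=
    spectrum.spectralRadius_lt_of_forall_lt X fun μ hμ => h μ hμ
  obtain ⟨r, hr1, hr2⟩ := ENNReal.lt_iff_exists_nnreal_btwn.mp hρ
  have hev := (spectrum.pow_nnnorm_pow_one_div_tendsto_nhds_spectralRadius X).eventually
    (gt_mem_nhds hr1)
  refine (tendsto_zero_iff_norm_tendsto_zero (E := Matrix (Fin n) (Fin n) ℂ)).mpr ?_
  have hr3 : (r : ℝ) < 1 := by exact_mod_cast hr2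
  refine squeeze_zero' (Eventually.of_forall fun k => norm_nonneg _) ?_
    (tendsto_pow_atTop_nhds_zero_of_lt_one r.2 hr3)
  filter_upwards [hev, eventually_gt_atTop 0] with k hk hk0
  have h1 : (‖X ^ k‖₊ : ENNReal) ≤ (r : ENNReal) ^ k := by
    have := ENNReal.rpow_le_rpow hk.le (z := (k : ℝ)) (by positivity)
    rwa [← ENNReal.rpow_mul, one_div, inv_mul_cancel₀ (by positivity), ENNReal.rpow_one,
      ENNReal.rpow_natCast] at this
  exact_mod_cast h1

lemma IsHurwitz.tendsto_cayley_pow (hA : IsHurwitz A) :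
    Tendsto (fun k => cayley A ^ k) atTop (𝓝 0) := by
  have h := tendsto_pow_of_forall_mem_spectrum
    (X := (cayley A).map Complex.ofReal) fun μ hμ => hA.norm_lt_one_of_mem_spectrum_cayley hμ
  have h2 := ((Continuous.matrix_map continuous_id Complex.continuous_re).tendsto
    (0 : Matrix (Fin n) (Fin n) ℂ)).comp h
  have h3 : (fun k => cayley A ^ k) = (fun X : Matrix (Fin n) (Fin n) ℂ => X.map Complex.re) ∘
      fun k => (cayley A).map Complex.ofReal ^ k := by
    funext k
    have : (cayley A).map Complex.ofReal ^ k = (cayley A ^ k).map Complex.ofReal :=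
      (map_pow Complex.ofRealHom.mapMatrix (cayley A) k).symm
    ext i j
    simp [this]
  rw [h3]
  have h4 : (0 : Matrix (Fin n) (Fin n) ℂ).map Complex.re = 0 := by ext i j; simp
  exact h4 ▸ h2

/-- A truncated Stein sum P = ∑_{j<k} (Cʲ)ᵀCʲ, with C the Cayley transform, suffices once Cᵏ has
Frobenius norm below 1: the difference telescopes to |Cᵏy|² - |y|², and the term j = 0 gives P ⪰ I.
-/
lemma IsHurwitz.exists_lyapunov (hA : IsHurwitz A) :
    ∃ P : Matrix (Fin n) (Fin n) ℝ, P.IsSymm ∧ (∀ x, x ⬝ᵥ x ≤ x ⬝ᵥ P *ᵥ x) ∧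
      ∀ x, x ≠ 0 → x ⬝ᵥ P *ᵥ (A *ᵥ x) < 0 := by
  set C := cayley A with hC
  have ht : Tendsto (fun k : ℕ => ∑ i, ∑ j, (C ^ k : Matrix _ _ ℝ) i j ^ 2) atTop (𝓝 0) := by
    have hcont : Continuous fun X : Matrix (Fin n) (Fin n) ℝ => ∑ i, ∑ j, X i j ^ 2 := by
      fun_prop
    have := (hcont.tendsto 0).comp hA.tendsto_cayley_pow
    simp only [Matrix.zero_apply, ne_eq, OfNat.ofNat_ne_zero, not_false_eq_true, zero_pow,
      Finset.sum_const_zero] at this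
    exact this
  obtain ⟨k, hk1, hk0⟩ := ((ht.eventually (gt_mem_nhds one_pos)).and
    (eventually_gt_atTop 0)).exists
  set P : Matrix (Fin n) (Fin n) ℝ := ∑ j ∈ Finset.range k, (C ^ j)ᵀ * C ^ j with hP
  have hq : ∀ x, x ⬝ᵥ P *ᵥ x = ∑ j ∈ Finset.range k, (C ^ j *ᵥ x) ⬝ᵥ (C ^ j *ᵥ x) := by
    intro x
    rw [hP, sum_mulVec, dotProduct_sum]
    refine Finset.sum_congr rfl fun j _ => ?_
    rw [← mulVec_mulVec, dotProduct_mulVec, ← mulVec_transpose, transpose_transpose]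
  have hPs : P.IsSymm := by
    rw [IsSymm, hP, transpose_sum]
    exact Finset.sum_congr rfl fun j _ => by rw [transpose_mul, transpose_transpose]
  refine ⟨P, hPs, fun x => ?_, fun z hz => ?_⟩
  · rw [hq]
    have := Finset.single_le_sum (f := fun j => (C ^ j *ᵥ x) ⬝ᵥ (C ^ j *ᵥ x))
      (fun j _ => dotProduct_self_nonneg_real _) (Finset.mem_range.mpr hk0)
    simpa using this
  · set y := A *ᵥ z - z with hy
    have hCy : C *ᵥ y = A *ᵥ z + z := hA.cayley_mulVec z
    have hy0 : y ≠ 0 := by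
      intro h0
      have h1 : A *ᵥ z = z := sub_eq_zero.mp h0
      rw [h0, mulVec_zero, h1] at hCy
      have h2 : (2 : ℝ) • z = 0 := by rw [two_smul]; exact hCy.symm
      exact hz (by simpa using h2)
    have h1 : (C *ᵥ y) ⬝ᵥ P *ᵥ (C *ᵥ y) - y ⬝ᵥ P *ᵥ y < 0 := by
      have hs : ∀ j, C ^ j *ᵥ (C *ᵥ y) = C ^ (j + 1) *ᵥ y := fun j => by
        rw [mulVec_mulVec, pow_succ]
      rw [hq, hq]
      simp only [hs]
      rw [← Finset.sum_sub_distrib,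
        Finset.sum_range_sub (fun j => (C ^ j *ᵥ y) ⬝ᵥ (C ^ j *ᵥ y))]
      have := mulVec_dotProduct_self_le (C ^ k) y
      have hpos := dotProduct_self_pos_real hy0
      simp only [pow_zero, one_mulVec]
      nlinarith
    rw [hCy, hy] at h1
    simp only [mulVec_add, mulVec_sub, dotProduct_add, dotProduct_sub, add_dotProduct,
      sub_dotProduct, dotProduct_mulVec_symm hPs (A *ᵥ z) z] at h1
    linarith

/-- Under the Cayley transform yᵀPy does not increase, and the iterates of y tend to 0, so the
initial value is at least 0. -/
lemma IsHurwitz.posSemidef_of_lyapunov (hA : IsHurwitz A) {P : Matrix (Fin n) (Fin n) ℝ}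
    (hP : P.IsSymm) (h : ∀ x, x ⬝ᵥ P *ᵥ (A *ᵥ x) ≤ 0) : P.PosSemidef := by
  have hstep : ∀ y, (cayley A *ᵥ y) ⬝ᵥ P *ᵥ (cayley A *ᵥ y) ≤ y ⬝ᵥ P *ᵥ y := by
    intro y
    obtain ⟨z, rfl⟩ := hA.exists_sub_eq y
    rw [hA.cayley_mulVec]
    simp only [mulVec_add, mulVec_sub, dotProduct_add, dotProduct_sub, add_dotProduct,
      sub_dotProduct, dotProduct_mulVec_symm hP (A *ᵥ z) z]
    linarith [h z]
  have hpow : ∀ k y, (cayley A ^ k *ᵥ y) ⬝ᵥ P *ᵥ (cayley A ^ k *ᵥ y) ≤ y ⬝ᵥ P *ᵥ y := by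
    intro k
    induction k with
    | zero => intro y; simp
    | succ k ih =>
      intro y
      rw [pow_succ, ← mulVec_mulVec]
      exact (ih _).trans (hstep y)
  refine PosSemidef.of_dotProduct_mulVec_nonneg (by simpa [IsHermitian] using hP.eq) fun y => ?_
  have hcont : Continuous fun X : Matrix (Fin n) (Fin n) ℝ => (X *ᵥ y) ⬝ᵥ P *ᵥ (X *ᵥ y) := by
    fun_prop
  have ht := (hcont.tendsto 0).comp hA.tendsto_cayley_pow
  simp only [zero_mulVec, zero_dotProduct] at ht
  simpa using le_of_tendsto ht (Eventually.of_forall fun k => hpow k y)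

end Stability

/-! ### Uniform margin of a negative definite form. -/

section NegativeForms

variable {α : Type*} [Fintype α]

/-- Compactness of the unit sphere. That sphere is for the sup norm, hence the Rayleigh quotient is
maximized instead of the form. -/
lemma exists_neg_bound (Θ : Matrix α α ℝ) (h : ∀ x, x ≠ 0 → x ⬝ᵥ Θ *ᵥ x < 0) :
    ∃ ε : ℝ, 0 < ε ∧ ∀ x, x ⬝ᵥ Θ *ᵥ x ≤ -ε * (x ⬝ᵥ x) := by
  have hc : ContinuousOn (fun x : α → ℝ => x ⬝ᵥ Θ *ᵥ x / (x ⬝ᵥ x)) (Metric.sphere 0 1) := by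
    refine ContinuousOn.div (by fun_prop) (by fun_prop) fun x hx => ?_
    have : x ≠ 0 := by rintro rfl; simp at hx
    exact (dotProduct_self_pos_real this).ne'
  rcases (Metric.sphere (0 : α → ℝ) 1).eq_empty_or_nonempty with he | hne
  · refine ⟨1, one_pos, fun x => ?_⟩
    by_cases hx : x = 0
    · simp [hx]
    · have : (‖x‖⁻¹ • x) ∈ Metric.sphere (0 : α → ℝ) 1 := by
        simp [norm_smul, inv_mul_cancel₀ (norm_ne_zero_iff.mpr hx)]
      simp [he] at this
  obtain ⟨x₀, hx₀, hmax⟩ := (isCompact_sphere (0 : α → ℝ) 1).exists_isMaxOn hne hc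
  have hx₀0 : x₀ ≠ 0 := by rintro rfl; simp at hx₀
  have hpos := dotProduct_self_pos_real hx₀0
  refine ⟨-(x₀ ⬝ᵥ Θ *ᵥ x₀ / (x₀ ⬝ᵥ x₀)), neg_pos.mpr (div_neg_of_neg_of_pos (h _ hx₀0) hpos),
    fun x => ?_⟩
  by_cases hx : x = 0
  · simp [hx]
  have hn : ‖x‖ ≠ 0 := norm_ne_zero_iff.mpr hx
  have hmem : (‖x‖⁻¹ • x) ∈ Metric.sphere (0 : α → ℝ) 1 := by
    simp [norm_smul, inv_mul_cancel₀ hn]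
  have := hmax hmem
  simp only [Set.mem_ofPred_eq, mulVec_smul, dotProduct_smul, smul_dotProduct, smul_eq_mul] at this
  rw [mul_div_mul_left _ _ (inv_ne_zero hn), mul_div_mul_left _ _ (inv_ne_zero hn),
    div_le_iff₀ (dotProduct_self_pos_real hx)] at this
  linarith

end NegativeForms

/-! ### Closure properties of square integrable signals. -/

section Signals

variable {α β : Type*}

lemma IsL2.add {f g : ℝ → α → ℝ} (hf : IsL2 f) (hg : IsL2 g) : IsL2 (fun t => f t + g t) :=
  fun k => (hf k).add (hg k)

lemma IsL2.sub {f g : ℝ → α → ℝ} (hf : IsL2 f) (hg : IsL2 g) : IsL2 (fun t => f t - g t) :=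
  fun k => (hf k).sub (hg k)

lemma IsL2.const_smul {f : ℝ → α → ℝ} (hf : IsL2 f) (c : ℝ) : IsL2 (fun t => c • f t) :=
  fun k => (hf k).const_mul c

lemma IsL2.mulVec [Fintype β] {f : ℝ → β → ℝ} (hf : IsL2 f) (X : Matrix α β ℝ) :
    IsL2 (fun t => X *ᵥ f t) := fun k => by
  simp only [Matrix.mulVec, dotProduct]
  exact memLp_finsetSum _ fun j _ => (hf j).const_mul (X k j)

lemma IsL2.sumElim {f : ℝ → α → ℝ} {g : ℝ → β → ℝ} (hf : IsL2 f) (hg : IsL2 g) :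
    IsL2 (fun t => Sum.elim (f t) (g t)) := fun k => by
  cases k with
  | inl i => exact hf i
  | inr j => exact hg j

lemma IsL2.integrable_dotProduct [Fintype α] {f g : ℝ → α → ℝ} (hf : IsL2 f) (hg : IsL2 g) :
    IntegrableOn (fun t => f t ⬝ᵥ g t) (Set.Ici 0) := by
  simp only [dotProduct]
  exact integrable_finsetSum _ fun i _ => MemLp.integrable_mul (hf i) (hg i)

lemma IsL2.intervalIntegrable {f : ℝ → α → ℝ} (hf : IsL2 f) {T : ℝ} (hT : 0 ≤ T) (k : α) :
    IntervalIntegrable (fun t => f t k) volume 0 T := by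
  rw [intervalIntegrable_iff_integrableOn_Ioc_of_le hT]
  have h : MemLp (fun t => f t k) 2 (volume.restrict (Set.Ioc 0 T)) :=
    (hf k).mono_measure (Measure.restrict_mono (fun t ht => ht.1.le) le_rfl)
  exact h.integrable (by norm_num)

end Signals

/-! ### Integration by parts for absolutely continuous functions. -/

section Products

lemma intervalIntegrable_finset_sum {ι : Type*} (s : Finset ι) {f : ι → ℝ → ℝ} {a b : ℝ}
    (h : ∀ i ∈ s, IntervalIntegrable (f i) volume a b) :
    IntervalIntegrable (fun t => ∑ i ∈ s, f i t) volume a b := by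
  have := IntervalIntegrable.sum s h
  rwa [Finset.sum_fn] at this

lemma absolutelyContinuousOnInterval_of_eq_integral {u g : ℝ → ℝ} {T : ℝ}
    (hg : IntervalIntegrable g volume 0 T) :
    AbsolutelyContinuousOnInterval (fun t => u 0 + ∫ s in (0 : ℝ)..t, g s) 0 T := by
  have h1 : AbsolutelyContinuousOnInterval (fun _ : ℝ => u 0) 0 T :=
    (LipschitzWith.const (u 0)).lipschitzOnWith.absolutelyContinuousOnInterval
  exact h1.add (hg.absolutelyContinuousOnInterval_intervalIntegral (by simp))

/-- Integration by parts for two indefinite integrals. -/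
lemma mul_sub_mul_eq_integral {u v g h : ℝ → ℝ} {T : ℝ} (hT : 0 ≤ T)
    (hg : IntervalIntegrable g volume 0 T) (hh : IntervalIntegrable h volume 0 T)
    (hu : ∀ t ∈ Set.Icc 0 T, u t = u 0 + ∫ s in (0 : ℝ)..t, g s)
    (hv : ∀ t ∈ Set.Icc 0 T, v t = v 0 + ∫ s in (0 : ℝ)..t, h s) :
    u T * v T - u 0 * v 0 = ∫ t in (0 : ℝ)..T, (g t * v t + u t * h t) := by
  have key := (absolutelyContinuousOnInterval_of_eq_integral (u := u) hg
    ).integral_deriv_mul_eq_sub (absolutelyContinuousOnInterval_of_eq_integral (u := v) hh)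
  rw [← hu T ⟨hT, le_rfl⟩, ← hv T ⟨hT, le_rfl⟩] at key
  simp only [intervalIntegral.integral_same, add_zero] at key
  rw [← key]
  -- The integrands are only locally integrable, so the derivatives are known only almost
  -- everywhere.
  apply intervalIntegral.integral_congr_ae
  filter_upwards [hg.ae_hasDerivAt_integral, hh.ae_hasDerivAt_integral] with t h1 h2 ht
  have ht' : t ∈ Set.uIcc 0 T := Set.uIoc_subset_uIcc ht
  have ht'' : t ∈ Set.Icc 0 T := by rwa [Set.uIcc_of_le hT] at ht'
  rw [((h1 ht' 0 (by simp)).const_add (u 0)).deriv, ((h2 ht' 0 (by simp)).const_add (v 0)).deriv,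
    ← hu t ht'', ← hv t ht'']

end Products

/-! ### Trajectories, energy balance and stability in L². -/

section Trajectories

variable {n : ℕ} {A : Matrix (Fin n) (Fin n) ℝ}

/-- `x` is a Carathéodory solution of `x' = A x + f` on `[0, ∞)`. -/
structure IsTrajectory (A : Matrix (Fin n) (Fin n) ℝ) (f x : ℝ → Fin n → ℝ) : Prop where
  continuousOn : ContinuousOn x (Set.Ici 0)
  eq_integral : ∀ t, 0 ≤ t → ∀ i, x t i = x 0 i + ∫ s in (0 : ℝ)..t, ((A *ᵥ x s) i + f s i)

lemma IsTrajectory.continuousOn_uIcc {f x : ℝ → Fin n → ℝ} (hx : IsTrajectory A f x) {T : ℝ}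
    (hT : 0 ≤ T) : ContinuousOn x (Set.uIcc 0 T) :=
  hx.continuousOn.mono fun t ht => by rw [Set.uIcc_of_le hT] at ht; exact ht.1

lemma IsTrajectory.intervalIntegrable_mulVec {f x : ℝ → Fin n → ℝ} (hx : IsTrajectory A f x)
    {T : ℝ} (hT : 0 ≤ T) (i : Fin n) :
    IntervalIntegrable (fun s => (A *ᵥ x s) i) volume 0 T := by
  refine ContinuousOn.intervalIntegrable ?_
  have := hx.continuousOn_uIcc hT
  fun_prop

lemma IsTrajectory.sub {f g x y : ℝ → Fin n → ℝ} (hx : IsTrajectory A f x)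
    (hy : IsTrajectory A g y) (hf : IsL2 f) (hg : IsL2 g) :
    IsTrajectory A (fun t => f t - g t) (fun t => x t - y t) := by
  refine ⟨hx.continuousOn.sub hy.continuousOn, fun t ht i => ?_⟩
  have h1 := (hx.intervalIntegrable_mulVec ht i).add (hf.intervalIntegrable ht i)
  have h2 := (hy.intervalIntegrable_mulVec ht i).add (hg.intervalIntegrable ht i)
  have h3 := intervalIntegral.integral_sub h1 h2
  have h4 : (∫ s in (0 : ℝ)..t, ((A *ᵥ (x s - y s)) i + (f s - g s) i))
      = ∫ s in (0 : ℝ)..t, ((A *ᵥ x s) i + f s i - ((A *ᵥ y s) i + g s i)) := by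
    refine intervalIntegral.integral_congr fun s _ => ?_
    simp only [mulVec_sub, Pi.sub_apply]
    ring
  simp only [Pi.sub_apply] at h4 ⊢
  rw [h4, h3, hx.eq_integral t ht i, hy.eq_integral t ht i]
  ring

lemma isTrajectory_of_hasDerivAt {f x : ℝ → Fin n → ℝ} (hf : Continuous f)
    (h : ∀ t, HasDerivAt x (A *ᵥ x t + f t) t) : IsTrajectory A f x := by
  have hc : Continuous x := continuous_iff_continuousAt.mpr fun t => (h t).continuousAt
  refine ⟨hc.continuousOn, fun t _ i => ?_⟩
  have := intervalIntegral.integral_eq_sub_of_hasDerivAt (a := 0) (b := t)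
    (fun s _ => hasDerivAt_pi.mp (h s) i)
    (Continuous.intervalIntegrable (by simp only [Pi.add_apply]; fun_prop) 0 t)
  simp only [Pi.add_apply] at this
  rw [this]
  ring

/-- The energy identity for a quadratic storage function along a trajectory. -/
lemma IsTrajectory.energy {f x : ℝ → Fin n → ℝ} (hx : IsTrajectory A f x) (hf : IsL2 f)
    {P : Matrix (Fin n) (Fin n) ℝ} (hP : P.IsSymm) {T : ℝ} (hT : 0 ≤ T) :
    x T ⬝ᵥ P *ᵥ x T - x 0 ⬝ᵥ P *ᵥ x 0
      = ∫ t in (0 : ℝ)..T, 2 * (x t ⬝ᵥ P *ᵥ (A *ᵥ x t + f t)) := by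
  set g : Fin n → ℝ → ℝ := fun i s => (A *ᵥ x s) i + f s i with hg
  have hgi : ∀ i, IntervalIntegrable (g i) volume 0 T := fun i =>
    (hx.intervalIntegrable_mulVec hT i).add (hf.intervalIntegrable hT i)
  have hxi : ∀ i, ContinuousOn (fun t => x t i) (Set.uIcc 0 T) := fun i => by
    have := hx.continuousOn_uIcc hT
    fun_prop
  have hprod : ∀ i j, x T i * x T j - x 0 i * x 0 j
      = ∫ t in (0 : ℝ)..T, (g i t * x t j + x t i * g j t) := fun i j =>
    mul_sub_mul_eq_integral (u := fun t => x t i) (v := fun t => x t j) hT (hgi i) (hgi j)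
      (fun t ht => hx.eq_integral t ht.1 i) (fun t ht => hx.eq_integral t ht.1 j)
  have hint : ∀ i j, IntervalIntegrable (fun t => P i j * (g i t * x t j + x t i * g j t))
      volume 0 T := fun i j =>
    (((hgi i).mul_continuousOn (hxi j)).add ((hgi j).continuousOn_mul (hxi i))).const_mul _
  have h1 : x T ⬝ᵥ P *ᵥ x T - x 0 ⬝ᵥ P *ᵥ x 0
      = ∑ i, ∑ j, P i j * (x T i * x T j - x 0 i * x 0 j) := by
    simp only [dotProduct, mulVec, Finset.mul_sum, ← Finset.sum_sub_distrib]
    exact Finset.sum_congr rfl fun i _ => Finset.sum_congr rfl fun j _ => by ring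
  have h2 : ∀ t, 2 * (x t ⬝ᵥ P *ᵥ (A *ᵥ x t + f t))
      = ∑ i, ∑ j, P i j * (g i t * x t j + x t i * g j t) := by
    intro t
    have e1 : x t ⬝ᵥ P *ᵥ (A *ᵥ x t + f t) = ∑ i, ∑ j, P i j * (x t i * g j t) := by
      simp only [dotProduct, mulVec, Finset.mul_sum, hg, Pi.add_apply]
      exact Finset.sum_congr rfl fun i _ => Finset.sum_congr rfl fun j _ => by ring
    -- Symmetry of `P` moves the derivative to the left factor, which supplies the other half of the
    -- product rule.
    have e2 : x t ⬝ᵥ P *ᵥ (A *ᵥ x t + f t) = ∑ i, ∑ j, P i j * (g i t * x t j) := by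
      rw [dotProduct_mulVec_symm hP]
      simp only [dotProduct, mulVec, Finset.mul_sum, hg, Pi.add_apply]
      exact Finset.sum_congr rfl fun i _ => Finset.sum_congr rfl fun j _ => by ring
    rw [two_mul]
    nth_rewrite 1 [e2]
    rw [e1]
    simp only [← Finset.sum_add_distrib, mul_add]
  rw [h1]
  simp only [h2]
  rw [intervalIntegral.integral_finsetSum fun i _ =>
    intervalIntegrable_finset_sum _ fun j _ => hint i j]
  refine Finset.sum_congr rfl fun i _ => ?_
  rw [intervalIntegral.integral_finsetSum fun j _ => hint i j]
  exact Finset.sum_congr rfl fun j _ => by rw [intervalIntegral.integral_const_mul, hprod]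

/-- Integrating the decay of a Lyapunov function xᵀPx. The constant is independent of T, which is
what makes the state square integrable. -/
lemma IsHurwitz.exists_energy_bound (hA : IsHurwitz A) :
    ∃ K : ℝ, 0 ≤ K ∧ ∀ f x : ℝ → Fin n → ℝ, IsL2 f → IsTrajectory A f x → ∀ T, 0 ≤ T →
      ∫ t in (0 : ℝ)..T, x t ⬝ᵥ x t
        ≤ K * (x 0 ⬝ᵥ x 0 + ∫ t in Set.Ici (0 : ℝ), f t ⬝ᵥ f t) := by
  obtain ⟨P, hPs, hPpos, hPA⟩ := hA.exists_lyapunov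
  obtain ⟨a, ha, hbound⟩ := exists_neg_bound (P * A) fun x hx => by
    rw [← mulVec_mulVec]; exact hPA x hx
  obtain ⟨C, hC0, hC⟩ := exists_bilinear_bound P
  refine ⟨(1 + C + 4 * C / a) / a, by positivity, fun f x hf hx T hT => ?_⟩
  have hxT := hx.continuousOn_uIcc hT
  have hxx : IntervalIntegrable (fun t => x t ⬝ᵥ x t) volume 0 T :=
    ContinuousOn.intervalIntegrable (by fun_prop)
  have hff : IntervalIntegrable (fun t => f t ⬝ᵥ f t) volume 0 T := by
    rw [intervalIntegrable_iff_integrableOn_Ioc_of_le hT]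
    exact (hf.integrable_dotProduct hf).mono_set fun t ht => ht.1.le
  have hxi : ∀ i, ContinuousOn (fun t => (P *ᵥ x t) i) (Set.uIcc 0 T) := fun i => by fun_prop
  have hE : IntervalIntegrable (fun t => 2 * (x t ⬝ᵥ P *ᵥ (A *ᵥ x t + f t))) volume 0 T := by
    simp only [dotProduct_mulVec_symm hPs (x _)]
    simp only [dotProduct]
    refine IntervalIntegrable.const_mul ?_ 2
    exact intervalIntegrable_finset_sum Finset.univ fun i _ =>
      (((hx.intervalIntegrable_mulVec hT i).add (hf.intervalIntegrable hT i)).mul_continuousOn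
        (hxi i))
  have hmono : ∫ t in (0 : ℝ)..T, 2 * (x t ⬝ᵥ P *ᵥ (A *ᵥ x t + f t))
      ≤ ∫ t in (0 : ℝ)..T, (-a * (x t ⬝ᵥ x t) + 4 * C / a * (f t ⬝ᵥ f t)) := by
    refine intervalIntegral.integral_mono_on hT hE
      ((hxx.const_mul _).add (hff.const_mul _)) fun t _ => ?_
    have h1 := hbound (x t)
    -- With weight a/2 the doubled cross term costs a|x|², half of the available decay 2a|x|².
    have h2 := (abs_le.mp (hC (a / 2) (by positivity) (x t) (f t))).2
    rw [← mulVec_mulVec] at h1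
    rw [mulVec_add, dotProduct_add]
    have h3 : C / (a / 2) = 2 * C / a := by field_simp
    rw [h3] at h2
    have h4 : 4 * C / a = 2 * (2 * C / a) := by ring
    rw [h4]
    nlinarith
  rw [← hx.energy hf hPs hT, intervalIntegral.integral_add (hxx.const_mul _) (hff.const_mul _),
    intervalIntegral.integral_const_mul, intervalIntegral.integral_const_mul] at hmono
  have hV0 : x 0 ⬝ᵥ P *ᵥ x 0 ≤ (1 + C) * (x 0 ⬝ᵥ x 0) := by
    have := (abs_le.mp (hC 1 one_pos (x 0) (x 0))).2
    rw [div_one] at this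
    linarith
  have hVT : 0 ≤ x T ⬝ᵥ P *ᵥ x T := (dotProduct_self_nonneg_real _).trans (hPpos _)
  have hfle : ∫ t in (0 : ℝ)..T, f t ⬝ᵥ f t ≤ ∫ t in Set.Ici (0 : ℝ), f t ⬝ᵥ f t := by
    rw [intervalIntegral.integral_of_le hT]
    exact setIntegral_mono_set (hf.integrable_dotProduct hf)
      (Eventually.of_forall fun t => dotProduct_self_nonneg_real _)
      (LE.le.eventuallyLE fun t ht => ht.1.le)
  have hF0 : 0 ≤ ∫ t in Set.Ici (0 : ℝ), f t ⬝ᵥ f t :=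
    integral_nonneg fun t => dotProduct_self_nonneg_real _
  have hx0 := dotProduct_self_nonneg_real (x 0)
  rw [div_mul_eq_mul_div, le_div_iff₀ ha]
  have hCa : 0 ≤ 4 * C / a := by positivity
  have := mul_le_mul_of_nonneg_left hfle hCa
  nlinarith [mul_nonneg hCa hx0, mul_nonneg hC0 hF0]

lemma IsTrajectory.isL2 (hA : IsHurwitz A) {f x : ℝ → Fin n → ℝ} (hx : IsTrajectory A f x)
    (hf : IsL2 f) : IsL2 x := by
  obtain ⟨K, hK, h⟩ := hA.exists_energy_bound
  intro k
  have hm : AEStronglyMeasurable (fun t => x t k) (volume.restrict (Set.Ici 0)) :=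
    ContinuousOn.aestronglyMeasurable (by have := hx.continuousOn; fun_prop) measurableSet_Ici
  rw [memLp_two_iff_integrable_sq hm]
  change IntegrableOn _ _ _
  rw [integrableOn_Ici_iff_integrableOn_Ioi]
  refine integrableOn_Ioi_of_intervalIntegral_norm_bounded (b := fun k : ℕ => (k : ℝ)) (l := atTop)
    (K * (x 0 ⬝ᵥ x 0 + ∫ t in Set.Ici (0 : ℝ), f t ⬝ᵥ f t)) 0 (fun N => ?_)
    tendsto_natCast_atTop_atTop (Eventually.of_forall fun N => ?_)
  · have hc := hx.continuousOn_uIcc N.cast_nonneg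
    rw [← intervalIntegrable_iff_integrableOn_Ioc_of_le N.cast_nonneg]
    exact ContinuousOn.intervalIntegrable (by fun_prop)
  · have hc := hx.continuousOn_uIcc N.cast_nonneg
    refine le_trans ?_ (h f x hf hx N N.cast_nonneg)
    refine intervalIntegral.integral_mono_on N.cast_nonneg
      (ContinuousOn.intervalIntegrable (by fun_prop))
      (ContinuousOn.intervalIntegrable (by fun_prop)) fun t _ => ?_
    rw [Real.norm_of_nonneg (sq_nonneg _), sq]
    exact Finset.single_le_sum (f := fun i => x t i * x t i) (fun i _ => mul_self_nonneg _)
      (Finset.mem_univ k)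

lemma IsHurwitz.exists_energy_bound_Ici (hA : IsHurwitz A) :
    ∃ K : ℝ, 0 ≤ K ∧ ∀ f x : ℝ → Fin n → ℝ, IsL2 f → IsTrajectory A f x →
      ∫ t in Set.Ici (0 : ℝ), x t ⬝ᵥ x t
        ≤ K * (x 0 ⬝ᵥ x 0 + ∫ t in Set.Ici (0 : ℝ), f t ⬝ᵥ f t) := by
  obtain ⟨K, hK, h⟩ := hA.exists_energy_bound
  refine ⟨K, hK, fun f x hf hx => ?_⟩
  have hi := (hx.isL2 hA hf).integrable_dotProduct (hx.isL2 hA hf)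
  rw [integral_Ici_eq_integral_Ioi (f := fun t => x t ⬝ᵥ x t)]
  refine le_of_tendsto (intervalIntegral_tendsto_integral_Ioi 0
    (hi.mono_set Set.Ioi_subset_Ici_self) tendsto_id) ?_
  filter_upwards [eventually_ge_atTop 0] with T hT using h f x hf hx T hT

end Trajectories

/-! ### The variation of constants formula. -/

section Convolution

variable {n : ℕ} {A : Matrix (Fin n) (Fin n) ℝ}

attribute [local instance] Matrix.linftyOpNormedRing Matrix.linftyOpNormedAlgebra in
lemma hasDerivAt_exp_smul_apply (A : Matrix (Fin n) (Fin n) ℝ) (i k : Fin n) (t : ℝ) :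
    HasDerivAt (fun s : ℝ => NormedSpace.exp (s • A) i k) ((A * NormedSpace.exp (t • A)) i k) t :=
  (LinearMap.toContinuousLinearMap (Matrix.entryLinearMap ℝ ℝ i k)).hasFDerivAt.comp_hasDerivAt t
    (hasDerivAt_exp_smul_const' (𝕂 := ℝ) A t)

lemma continuous_exp_smul_apply (A : Matrix (Fin n) (Fin n) ℝ) (i k : Fin n) :
    Continuous fun s : ℝ => NormedSpace.exp (s • A) i k :=
  continuous_iff_continuousAt.mpr fun t => (hasDerivAt_exp_smul_apply A i k t).continuousAt

lemma exp_smul_apply_eq_integral (A : Matrix (Fin n) (Fin n) ℝ) (i k : Fin n) (t : ℝ) :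
    NormedSpace.exp (t • A) i k = NormedSpace.exp ((0 : ℝ) • A) i k
      + ∫ s in (0 : ℝ)..t, (A * NormedSpace.exp (s • A)) i k := by
  have hc : Continuous fun s : ℝ => (A * NormedSpace.exp (s • A)) i k := by
    simp only [Matrix.mul_apply]
    exact continuous_finsetSum _ fun j _ =>
      continuous_const.mul (continuous_exp_smul_apply A j k)
  have := intervalIntegral.integral_eq_sub_of_hasDerivAt
    (fun s _ => hasDerivAt_exp_smul_apply A i k s) (hc.intervalIntegrable 0 t)
  exact (add_eq_of_eq_sub' this).symm

lemma exp_smul_mulVec_exp_neg_smul (A : Matrix (Fin n) (Fin n) ℝ) (t s : ℝ) (v : Fin n → ℝ) :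
    NormedSpace.exp (t • A) *ᵥ (NormedSpace.exp ((-s) • A) *ᵥ v)
      = NormedSpace.exp ((t - s) • A) *ᵥ v := by
  have hcomm : Commute (t • A) ((-s) • A) := (Commute.refl A).smul_left t |>.smul_right (-s)
  rw [mulVec_mulVec, ← Matrix.exp_add_of_commute _ _ hcomm, ← add_smul, sub_eq_add_neg]

lemma intervalIntegrable_pi {f : ℝ → Fin n → ℝ} {a b : ℝ}
    (h : ∀ k, IntervalIntegrable (fun t => f t k) volume a b) :
    IntervalIntegrable f volume a b :=
  ⟨Integrable.of_eval fun k => (h k).1, Integrable.of_eval fun k => (h k).2⟩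

/-- The variation of constants formula solves `x' = A x + f`, `x(0) = 0`. -/
lemma isTrajectory_convolution {f : ℝ → Fin n → ℝ} (hf : IsL2 f) :
    IsTrajectory A f
      (fun t => ∫ s in (0 : ℝ)..t, NormedSpace.exp ((t - s) • A) *ᵥ f s) := by
  set E : ℝ → Matrix (Fin n) (Fin n) ℝ := fun t => NormedSpace.exp (t • A) with hE
  set g : ℝ → Fin n → ℝ := fun s => E (-s) *ᵥ f s with hg
  set x : ℝ → Fin n → ℝ := fun t => ∫ s in (0 : ℝ)..t, NormedSpace.exp ((t - s) • A) *ᵥ f s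
    with hx
  have hEc : ∀ i k, Continuous fun s => E s i k := continuous_exp_smul_apply A
  have hgk : ∀ T, 0 ≤ T → ∀ k, IntervalIntegrable (fun s => g s k) volume 0 T := by
    intro T hT k
    simp only [hg, mulVec, dotProduct]
    refine intervalIntegrable_finset_sum _ fun j _ => ?_
    exact (hf.intervalIntegrable hT j).continuousOn_mul
      ((hEc k j).comp continuous_neg).continuousOn
  set y : Fin n → ℝ → ℝ := fun k t => ∫ s in (0 : ℝ)..t, g s k with hy
  have hy0 : ∀ k, y k 0 = 0 := fun k => by simp [hy]
  -- Splitting exp((t-s)A) = exp(tA)exp(-sA) writes x as E(t) times an indefinite integral, to which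
  -- the product rule applies.
  have hxy : ∀ t, 0 ≤ t → ∀ i, x t i = ∑ k, E t i k * y k t := by
    intro t ht i
    have h1 : x t = E t *ᵥ ∫ s in (0 : ℝ)..t, g s := by
      have := ContinuousLinearMap.intervalIntegral_comp_comm
        (LinearMap.toContinuousLinearMap (Matrix.mulVecLin (E t)))
        (intervalIntegrable_pi (hgk t ht))
      simp only [LinearMap.coe_toContinuousLinearMap', mulVecLin_apply] at this
      rw [← this]
      exact intervalIntegral.integral_congr fun s _ =>
        (exp_smul_mulVec_exp_neg_smul A t s (f s)).symm
    have h2 : ∀ k, (∫ s in (0 : ℝ)..t, g s) k = y k t := fun k =>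
      (ContinuousLinearMap.intervalIntegral_comp_comm
        (ContinuousLinearMap.proj (R := ℝ) (φ := fun _ : Fin n => ℝ) k)
        (intervalIntegrable_pi (hgk t ht))).symm
    rw [h1]
    simp only [mulVec, dotProduct, h2]
  have hyc : ∀ k T, 0 ≤ T → ContinuousOn (y k) (Set.uIcc 0 T) := fun k T hT =>
    ((hgk T hT k).absolutelyContinuousOnInterval_intervalIntegral (by simp)).continuousOn
  have hxc : ∀ T, 0 ≤ T → ContinuousOn x (Set.uIcc 0 T) := by
    intro T hT
    refine continuousOn_pi.mpr fun i => ?_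
    refine ContinuousOn.congr (f := fun t => ∑ k, E t i k * y k t) ?_ fun t ht => ?_
    · exact continuousOn_finsetSum _ fun k _ => (hEc i k).continuousOn.mul (hyc k T hT)
    · rw [Set.uIcc_of_le hT] at ht
      exact hxy t ht.1 i
  refine ⟨fun t ht => ?_, fun t ht i => ?_⟩
  · have ht0 : (0 : ℝ) ≤ t := ht
    have hmem : t ∈ Set.uIcc 0 (t + 1) := by
      rw [Set.uIcc_of_le (by linarith)]; exact ⟨ht0, by linarith⟩
    refine (hxc (t + 1) (by linarith) t hmem).mono_of_mem_nhdsWithin ?_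
    rw [Set.uIcc_of_le (by linarith : (0 : ℝ) ≤ t + 1)]
    filter_upwards [self_mem_nhdsWithin, mem_nhdsWithin_of_mem_nhds (Iio_mem_nhds (lt_add_one t))]
      with s hs1 hs2
    exact ⟨hs1, le_of_lt hs2⟩
  · have hAE : ∀ k, Continuous fun s => (A * E s) i k := fun k => by
      simp only [Matrix.mul_apply]
      exact continuous_finsetSum _ fun j _ => continuous_const.mul (hEc j k)
    have hprod : ∀ k, E t i k * y k t
        = ∫ s in (0 : ℝ)..t, ((A * E s) i k * y k s + E s i k * g s k) := by
      intro k
      have := mul_sub_mul_eq_integral (u := fun s => E s i k) (v := y k) ht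
        ((hAE k).intervalIntegrable 0 t) (hgk t ht k)
        (fun s _ => exp_smul_apply_eq_integral A i k s) (fun s _ => by rw [hy0, zero_add])
      rw [hy0, mul_zero, sub_zero] at this
      exact this
    have hint : ∀ k, IntervalIntegrable
        (fun s => (A * E s) i k * y k s + E s i k * g s k) volume 0 t := fun k =>
      (ContinuousOn.intervalIntegrable ((hAE k).continuousOn.mul (hyc k t ht))).add
        ((hgk t ht k).continuousOn_mul (hEc i k).continuousOn)
    have hx0 : x 0 i = 0 := by simp [hx]
    rw [hx0, zero_add, hxy t ht i, Finset.sum_congr rfl fun k _ => hprod k,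
      ← intervalIntegral.integral_finsetSum fun k _ => hint k]
    refine intervalIntegral.integral_congr fun s hs => ?_
    rw [Set.uIcc_of_le ht] at hs
    simp only [Finset.sum_add_distrib]
    congr 1
    · simp only [mulVec, dotProduct, hxy s hs.1, Matrix.mul_apply, Finset.mul_sum,
        Finset.sum_mul]
      rw [Finset.sum_comm]
      exact Finset.sum_congr rfl fun k _ => Finset.sum_congr rfl fun j _ => by ring
    -- E(s)E(-s) = 1 returns the forcing term.
    · have := congrFun (exp_smul_mulVec_exp_neg_smul A s s (f s)) i
      rw [sub_self, zero_smul, NormedSpace.exp_zero, one_mulVec] at this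
      exact this

end Convolution

/-! ### From a storage function to the integral inequality. -/

section Dissipation

variable {n : ℕ} {A : Matrix (Fin n) (Fin n) ℝ} {κ : Type*} [Fintype κ]

/-- A nonzero limit would keep |v| above |L|/2 on a half-line of infinite measure. -/
lemma eq_zero_of_tendsto_of_integrableOn_Ioi {v : ℝ → ℝ} {L : ℝ} (hv : IntegrableOn v (Set.Ioi 0))
    (h : Tendsto v atTop (𝓝 L)) : L = 0 := by
  by_contra hL
  have hpos : 0 < |L| / 2 := by positivity
  have hev : ∀ᶠ t in atTop, |L| / 2 < |v t| :=
    h.abs.eventually (lt_mem_nhds (by have := abs_pos.mpr hL; linarith))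
  obtain ⟨T, hT⟩ := eventually_atTop.mp hev
  have hc : IntegrableOn (fun _ : ℝ => |L| / 2) (Set.Ioi (max T 0)) := by
    refine Integrable.mono (hv.mono_set (Set.Ioi_subset_Ioi (le_max_right T 0)))
      aestronglyMeasurable_const ?_
    filter_upwards [ae_restrict_mem measurableSet_Ioi] with t ht
    rw [Real.norm_of_nonneg hpos.le]
    exact (hT t ((le_max_left T 0).trans ht.le)).le
  rw [integrableOn_const_iff] at hc
  rcases hc with h0 | h0
  · exact hpos.ne' (enorm_eq_zero.mp h0)
  · simp at h0

/-- The storage xᵀPx has a limit, because its derivative is integrable, and is itself integrable; so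
the limit is 0 whatever the sign of `P`. -/
lemma IsTrajectory.integral_energy (hA : IsHurwitz A) {f x : ℝ → Fin n → ℝ}
    (hx : IsTrajectory A f x) (hf : IsL2 f) {P : Matrix (Fin n) (Fin n) ℝ} (hP : P.IsSymm) :
    ∫ t in Set.Ici (0 : ℝ), 2 * (x t ⬝ᵥ P *ᵥ (A *ᵥ x t + f t)) = -(x 0 ⬝ᵥ P *ᵥ x 0) := by
  have hxL := hx.isL2 hA hf
  have hi : IntegrableOn (fun t => 2 * (x t ⬝ᵥ P *ᵥ (A *ᵥ x t + f t))) (Set.Ici 0) :=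
    (hxL.integrable_dotProduct (((hxL.mulVec A).add hf).mulVec P)).const_mul 2
  have hV : IntegrableOn (fun t => x t ⬝ᵥ P *ᵥ x t) (Set.Ici 0) :=
    hxL.integrable_dotProduct (hxL.mulVec P)
  have ht := intervalIntegral_tendsto_integral_Ioi 0 (hi.mono_set Set.Ioi_subset_Ici_self)
    tendsto_id
  rw [← integral_Ici_eq_integral_Ioi] at ht
  have ht2 : Tendsto (fun T => x T ⬝ᵥ P *ᵥ x T) atTop
      (𝓝 ((∫ t in Set.Ici (0 : ℝ), 2 * (x t ⬝ᵥ P *ᵥ (A *ᵥ x t + f t))) + x 0 ⬝ᵥ P *ᵥ x 0)) := by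
    refine (ht.add_const (x 0 ⬝ᵥ P *ᵥ x 0)).congr' ?_
    filter_upwards [eventually_ge_atTop 0] with T hT
    rw [id, ← hx.energy hf hP hT]
    ring
  have := eq_zero_of_tendsto_of_integrableOn_Ioi (hV.mono_set Set.Ioi_subset_Ici_self) ht2
  linarith

/-- Dissipativity: a strict linear matrix inequality implies the integral inequality. -/
lemma IsTrajectory.integral_le_of_dissipation (hA : IsHurwitz A) {b : Matrix (Fin n) κ ℝ}
    {Θ : Matrix (Fin n ⊕ κ) (Fin n ⊕ κ) ℝ} {P : Matrix (Fin n) (Fin n) ℝ} (hP : P.IsSymm) {ε : ℝ}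
    (hε : ∀ x u, 2 * (x ⬝ᵥ P *ᵥ (A *ᵥ x + b *ᵥ u)) + Sum.elim x u ⬝ᵥ Θ *ᵥ Sum.elim x u
      ≤ -ε * (u ⬝ᵥ u))
    {x : ℝ → Fin n → ℝ} {q : ℝ → κ → ℝ} (hq : IsL2 q)
    (hx : IsTrajectory A (fun t => b *ᵥ q t) x) (hx0 : x 0 = 0) :
    ∫ t in Set.Ici (0 : ℝ), Sum.elim (x t) (q t) ⬝ᵥ Θ *ᵥ Sum.elim (x t) (q t)
      ≤ -ε * ∫ t in Set.Ici (0 : ℝ), q t ⬝ᵥ q t := by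
  have hf : IsL2 fun t => b *ᵥ q t := hq.mulVec b
  have hxL := hx.isL2 hA hf
  have hw := hxL.sumElim hq
  have hE := hx.integral_energy hA hf hP
  rw [hx0, zero_dotProduct, neg_zero] at hE
  have hi1 : IntegrableOn (fun t => 2 * (x t ⬝ᵥ P *ᵥ (A *ᵥ x t + b *ᵥ q t))) (Set.Ici 0) :=
    (hxL.integrable_dotProduct (((hxL.mulVec A).add hf).mulVec P)).const_mul 2
  have hi2 := hw.integrable_dotProduct (hw.mulVec Θ)
  have := integral_mono (hi1.add hi2) ((hq.integrable_dotProduct hq).const_mul (-ε))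
    fun t => hε (x t) (q t)
  simp only [Pi.add_apply] at this
  rw [integral_add hi1 hi2, hE, zero_add, integral_const_mul] at this
  exact this

end Dissipation

/-! ### Damped sinusoids as test signals. -/

section DampedRotation

variable {α β : Type*}

/-- The real part of `exp ((-σ + jω) t) (p + j r)`. -/
noncomputable def dampedRotation (σ ω : ℝ) (p r : α → ℝ) (t : ℝ) : α → ℝ :=
  (Real.exp (-σ * t) * Real.cos (ω * t)) • p - (Real.exp (-σ * t) * Real.sin (ω * t)) • r

lemma dampedRotation_sumElim (σ ω : ℝ) (p r : α → ℝ) (p' r' : β → ℝ) (t : ℝ) :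
    dampedRotation σ ω (Sum.elim p p') (Sum.elim r r') t
      = Sum.elim (dampedRotation σ ω p r t) (dampedRotation σ ω p' r' t) := by
  ext k; cases k <;> simp [dampedRotation]

lemma mulVec_dampedRotation [Fintype β] (X : Matrix α β ℝ) (σ ω : ℝ) (p r : β → ℝ) (t : ℝ) :
    X *ᵥ dampedRotation σ ω p r t = dampedRotation σ ω (X *ᵥ p) (X *ᵥ r) t := by
  simp [dampedRotation, mulVec_sub, mulVec_smul]

lemma dampedRotation_zero (σ ω : ℝ) (p r : α → ℝ) : dampedRotation σ ω p r 0 = p := by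
  simp [dampedRotation]

/-- `dampedRotation σ ω r (-p)` is the imaginary part of the same complex signal, so this is the
real part of multiplication by -σ + jω. -/
lemma hasDerivAt_dampedRotation [Fintype α] (σ ω : ℝ) (p r : α → ℝ) (t : ℝ) :
    HasDerivAt (dampedRotation σ ω p r)
      (-σ • dampedRotation σ ω p r t - ω • dampedRotation σ ω r (-p) t) t := by
  have he : HasDerivAt (fun s => Real.exp (-σ * s)) (Real.exp (-σ * t) * -σ) t := by
    simpa using ((hasDerivAt_id t).const_mul (-σ)).exp
  have hc : HasDerivAt (fun s => Real.cos (ω * s)) (-Real.sin (ω * t) * ω) t := by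
    simpa using ((hasDerivAt_id t).const_mul ω).cos
  have hs : HasDerivAt (fun s => Real.sin (ω * s)) (Real.cos (ω * t) * ω) t := by
    simpa using ((hasDerivAt_id t).const_mul ω).sin
  have h : HasDerivAt (dampedRotation σ ω p r) _ t :=
    ((he.mul hc).smul_const p).sub ((he.mul hs).smul_const r)
  refine h.congr_deriv ?_
  ext k
  simp only [dampedRotation, Pi.sub_apply, Pi.smul_apply, Pi.neg_apply, smul_eq_mul]
  ring

lemma continuous_dampedRotation [Fintype α] (σ ω : ℝ) (p r : α → ℝ) :
    Continuous (dampedRotation σ ω p r) :=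
  continuous_iff_continuousAt.mpr fun t => (hasDerivAt_dampedRotation σ ω p r t).continuousAt

/-- Adding the forms of the real and imaginary parts cancels the cross terms through cos² + sin² =
1, and no oscillation is left. -/
lemma dampedRotation_quadratic [Fintype α] (Θ : Matrix α α ℝ) (σ ω : ℝ) (p r : α → ℝ) (t : ℝ) :
    dampedRotation σ ω p r t ⬝ᵥ Θ *ᵥ dampedRotation σ ω p r t
      + dampedRotation σ ω r (-p) t ⬝ᵥ Θ *ᵥ dampedRotation σ ω r (-p) t
      = Real.exp (-(2 * σ) * t) * (p ⬝ᵥ Θ *ᵥ p + r ⬝ᵥ Θ *ᵥ r) := by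
  have he : Real.exp (-(2 * σ) * t) = Real.exp (-σ * t) ^ 2 := by
    rw [← Real.exp_nat_mul]; congr 1; push_cast; ring
  have hcs := Real.cos_sq_add_sin_sq (ω * t)
  rw [he]
  simp only [dampedRotation, mulVec_sub, mulVec_smul, mulVec_neg, dotProduct_sub, dotProduct_smul,
    sub_dotProduct, smul_dotProduct, neg_dotProduct, dotProduct_neg, smul_eq_mul, smul_neg]
  linear_combination (Real.exp (-σ * t) ^ 2 * (p ⬝ᵥ Θ *ᵥ p + r ⬝ᵥ Θ *ᵥ r)) * hcs

lemma integrableOn_exp_neg_Ici {c : ℝ} (hc : 0 < c) :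
    IntegrableOn (fun t => Real.exp (-c * t)) (Set.Ici 0) := by
  have h := exp_neg_integrableOn_Ioi 0 hc
  exact (integrableOn_Ici_iff_integrableOn_Ioi).mpr h

lemma integral_exp_neg_Ici {c : ℝ} (hc : 0 < c) :
    ∫ t in Set.Ici (0 : ℝ), Real.exp (-c * t) = 1 / c := by
  rw [integral_Ici_eq_integral_Ioi, integral_exp_mul_Ioi (by linarith) 0]
  simp

lemma isL2_dampedRotation [Fintype α] {σ : ℝ} (hσ : 0 < σ) (ω : ℝ) (p r : α → ℝ) :
    IsL2 (dampedRotation σ ω p r) := by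
  intro k
  have hm : Continuous fun t => dampedRotation σ ω p r t k := by
    have := continuous_dampedRotation σ ω p r
    fun_prop
  rw [memLp_two_iff_integrable_sq hm.aestronglyMeasurable]
  refine Integrable.mono' ((integrableOn_exp_neg_Ici (c := 2 * σ) (by positivity)).const_mul
    (p k ^ 2 + r k ^ 2)) (hm.pow 2).aestronglyMeasurable (Eventually.of_forall fun t => ?_)
  have he : Real.exp (-(2 * σ) * t) = Real.exp (-σ * t) ^ 2 := by
    rw [← Real.exp_nat_mul]; congr 1; push_cast; ring
  rw [Real.norm_of_nonneg (sq_nonneg _), he]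
  have hcs := Real.cos_sq_add_sin_sq (ω * t)
  simp only [dampedRotation, Pi.sub_apply, Pi.smul_apply, smul_eq_mul]
  have h2 : (Real.cos (ω * t) * p k - Real.sin (ω * t) * r k) ^ 2 ≤ p k ^ 2 + r k ^ 2 := by
    have : p k ^ 2 + r k ^ 2 - (Real.cos (ω * t) * p k - Real.sin (ω * t) * r k) ^ 2
        = (Real.sin (ω * t) * p k + Real.cos (ω * t) * r k) ^ 2 := by
      linear_combination -(p k ^ 2 + r k ^ 2) * hcs
    nlinarith [sq_nonneg (Real.sin (ω * t) * p k + Real.cos (ω * t) * r k)]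
  have := mul_le_mul_of_nonneg_right h2 (sq_nonneg (Real.exp (-σ * t)))
  refine le_trans (le_of_eq ?_) this
  ring

lemma integral_dampedRotation_add [Fintype α] {σ : ℝ} (hσ : 0 < σ) (ω : ℝ) (Θ : Matrix α α ℝ)
    (p r : α → ℝ) :
    (∫ t in Set.Ici (0 : ℝ), dampedRotation σ ω p r t ⬝ᵥ Θ *ᵥ dampedRotation σ ω p r t)
      + (∫ t in Set.Ici (0 : ℝ), dampedRotation σ ω r (-p) t ⬝ᵥ
          Θ *ᵥ dampedRotation σ ω r (-p) t)
      = 1 / (2 * σ) * (p ⬝ᵥ Θ *ᵥ p + r ⬝ᵥ Θ *ᵥ r) := by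
  have l1 := isL2_dampedRotation hσ ω p r
  have l2 := isL2_dampedRotation hσ ω r (-p)
  rw [← integral_add (l1.integrable_dotProduct (l1.mulVec Θ))
    (l2.integrable_dotProduct (l2.mulVec Θ))]
  simp only [dampedRotation_quadratic]
  rw [integral_mul_const, integral_exp_neg_Ici (by positivity)]

end DampedRotation

/-! ### From the time domain to the frequency domain. -/

section TestSignals

variable {n : ℕ} {A : Matrix (Fin n) (Fin n) ℝ} {κ : Type*} [Fintype κ] {b : Matrix (Fin n) κ ℝ}

/-- The hypotheses are the real coordinates of jωx = Ax + bv. Since the exponent is -σ + jω and not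
jω, the steady state is a trajectory only up to the defect -σz. -/
lemma isTrajectory_dampedRotation {ω : ℝ} {x₁ x₂ : Fin n → ℝ} {v₁ v₂ : κ → ℝ}
    (h₁ : A *ᵥ x₁ + b *ᵥ v₁ = -ω • x₂) (h₂ : A *ᵥ x₂ + b *ᵥ v₂ = ω • x₁) (σ : ℝ) :
    IsTrajectory A (fun t => b *ᵥ dampedRotation σ ω v₁ v₂ t - σ • dampedRotation σ ω x₁ x₂ t)
      (dampedRotation σ ω x₁ x₂) := by
  have hq := continuous_dampedRotation σ ω v₁ v₂
  have hz := continuous_dampedRotation σ ω x₁ x₂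
  refine isTrajectory_of_hasDerivAt (by fun_prop) fun t => ?_
  convert hasDerivAt_dampedRotation σ ω x₁ x₂ t using 1
  have e : A *ᵥ dampedRotation σ ω x₁ x₂ t + b *ᵥ dampedRotation σ ω v₁ v₂ t
      = -ω • dampedRotation σ ω x₂ (-x₁) t := by
    rw [mulVec_dampedRotation, mulVec_dampedRotation]
    have : ∀ p p' r r' : Fin n → ℝ, dampedRotation σ ω p r t + dampedRotation σ ω p' r' t
        = dampedRotation σ ω (p + p') (r + r') t := fun p p' r r' => by
      ext k
      simp only [dampedRotation, Pi.add_apply, Pi.sub_apply, Pi.smul_apply, smul_eq_mul]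
      ring
    rw [this, h₁, h₂]
    ext k
    simp only [dampedRotation, Pi.neg_apply, Pi.sub_apply, Pi.smul_apply, smul_eq_mul]
    ring
  rw [← add_sub_assoc, e]
  ext k
  simp only [Pi.sub_apply, Pi.smul_apply, smul_eq_mul]
  ring

/-- Steady state approximation of the response to a slowly damped sinusoid. -/
lemma integral_dampedRotation_le {Θ : Matrix (Fin n ⊕ κ) (Fin n ⊕ κ) ℝ} (hΘ : Θ.IsSymm)
    {K C : ℝ}
    (hK : ∀ f x : ℝ → Fin n → ℝ, IsL2 f → IsTrajectory A f x →
      ∫ t in Set.Ici (0 : ℝ), x t ⬝ᵥ x t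
        ≤ K * (x 0 ⬝ᵥ x 0 + ∫ t in Set.Ici (0 : ℝ), f t ⬝ᵥ f t))
    (hC0 : 0 ≤ C)
    (hC : ∀ δ : ℝ, 0 < δ → ∀ a v, |a ⬝ᵥ Θ *ᵥ v| ≤ δ * (a ⬝ᵥ a) + C / δ * (v ⬝ᵥ v))
    (hA : IsHurwitz A)
    {x : ℝ → Fin n → ℝ} {ω : ℝ} {x₁ x₂ : Fin n → ℝ} {v₁ v₂ : κ → ℝ}
    (h₁ : A *ᵥ x₁ + b *ᵥ v₁ = -ω • x₂) (h₂ : A *ᵥ x₂ + b *ᵥ v₂ = ω • x₁)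
    {σ δ : ℝ} (hσ : 0 < σ) (hδ : 0 < δ)
    (hx : IsTrajectory A (fun t => b *ᵥ dampedRotation σ ω v₁ v₂ t) x) (hx0 : x 0 = 0)
    (hneg : ∫ t in Set.Ici (0 : ℝ), Sum.elim (x t) (dampedRotation σ ω v₁ v₂ t) ⬝ᵥ
      Θ *ᵥ Sum.elim (x t) (dampedRotation σ ω v₁ v₂ t) ≤ 0) :
    (∫ t in Set.Ici (0 : ℝ), dampedRotation σ ω (Sum.elim x₁ v₁) (Sum.elim x₂ v₂) t ⬝ᵥ
        Θ *ᵥ dampedRotation σ ω (Sum.elim x₁ v₁) (Sum.elim x₂ v₂) t)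
      ≤ 2 * δ * (∫ t in Set.Ici (0 : ℝ), dampedRotation σ ω (Sum.elim x₁ v₁) (Sum.elim x₂ v₂) t ⬝ᵥ
          dampedRotation σ ω (Sum.elim x₁ v₁) (Sum.elim x₂ v₂) t)
        + (2 * C / δ + 1 + C) * (K * (x₁ ⬝ᵥ x₁ + σ ^ 2 *
          ∫ t in Set.Ici (0 : ℝ), dampedRotation σ ω x₁ x₂ t ⬝ᵥ dampedRotation σ ω x₁ x₂ t)) := by
  set q := dampedRotation σ ω v₁ v₂ with hq
  set z := dampedRotation σ ω x₁ x₂ with hz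
  set w := dampedRotation σ ω (Sum.elim x₁ v₁) (Sum.elim x₂ v₂) with hw
  have hqL : IsL2 q := isL2_dampedRotation hσ ω v₁ v₂
  have hzL : IsL2 z := isL2_dampedRotation hσ ω x₁ x₂
  have hwL : IsL2 w := isL2_dampedRotation hσ ω _ _
  have hbq : IsL2 fun t => b *ᵥ q t := hqL.mulVec b
  have hz' : IsTrajectory A (fun t => b *ᵥ q t - σ • z t) z := isTrajectory_dampedRotation h₁ h₂ σ
  -- The true response minus the steady state starts at -x₁ and is driven by σz alone, so the energy
  -- bound controls it.
  have he := hx.sub hz' hbq (hbq.sub (hzL.const_smul σ))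
  simp only [sub_sub_cancel] at he
  have heL := he.isL2 hA (hzL.const_smul σ)
  have hz0 : z 0 = x₁ := dampedRotation_zero σ ω x₁ x₂
  have hebound := hK _ _ (hzL.const_smul σ) he
  simp only [hx0, hz0, zero_sub, neg_dotProduct, dotProduct_neg, neg_neg,
    smul_dotProduct, dotProduct_smul, smul_eq_mul, ← mul_assoc, ← sq, integral_const_mul]
    at hebound
  set E : ℝ → (Fin n ⊕ κ) → ℝ := fun t => Sum.elim (x t - z t) 0 with hE
  have hEE : ∀ t, E t ⬝ᵥ E t = (x t - z t) ⬝ᵥ (x t - z t) := fun t => by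
    simp [hE, dotProduct]
  have hsplit : ∀ t, Sum.elim (x t) (q t) = w t + E t := fun t => by
    rw [hw, dampedRotation_sumElim]
    ext k; cases k <;> simp [hE, hz, hq]
  have hpt : ∀ t, w t ⬝ᵥ Θ *ᵥ w t ≤ Sum.elim (x t) (q t) ⬝ᵥ Θ *ᵥ Sum.elim (x t) (q t)
      + (2 * δ * (w t ⬝ᵥ w t) + (2 * C / δ + 1 + C) * ((x t - z t) ⬝ᵥ (x t - z t))) := by
    intro t
    have b1 := (abs_le.mp (hC δ hδ (w t) (E t))).1
    have b2 := (abs_le.mp (hC 1 one_pos (E t) (E t))).1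
    rw [hsplit, ← hEE]
    simp only [mulVec_add, dotProduct_add, add_dotProduct, dotProduct_mulVec_symm hΘ (E t) (w t)]
    have e1 : 2 * C / δ = 2 * (C / δ) := by ring
    rw [div_one] at b2
    rw [e1]
    linarith
  have i0 := hwL.integrable_dotProduct (hwL.mulVec Θ)
  have i1 : IntegrableOn (fun t => Sum.elim (x t) (q t) ⬝ᵥ Θ *ᵥ Sum.elim (x t) (q t))
      (Set.Ici 0) := by
    have := (hx.isL2 hA hbq).sumElim hqL
    exact this.integrable_dotProduct (this.mulVec Θ)
  have i2 := (hwL.integrable_dotProduct hwL).const_mul (2 * δ)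
  have i3 := (heL.integrable_dotProduct heL).const_mul (2 * C / δ + 1 + C)
  have hmono := integral_mono i0 (i1.add (i2.add i3)) hpt
  have i23 := integral_add i2 i3
  have i123 := integral_add i1 (i2.add i3)
  simp only [Pi.add_apply] at hmono i123
  rw [i123, i23, integral_const_mul, integral_const_mul] at hmono
  have hcoef : 0 ≤ 2 * C / δ + 1 + C := by positivity
  have := mul_le_mul_of_nonneg_left hebound hcoef
  linarith

/-- The integral inequality implies the frequency domain inequality. -/
lemma freq_le_of_time_le (hA : IsHurwitz A) {Θ : Matrix (Fin n ⊕ κ) (Fin n ⊕ κ) ℝ}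
    (hΘ : Θ.IsSymm)
    (h : ∀ (q : ℝ → κ → ℝ) (x : ℝ → Fin n → ℝ), IsL2 q → x =
        (fun t => ∫ s in (0 : ℝ)..t, NormedSpace.exp ((t - s) • A) *ᵥ (b *ᵥ q s)) →
      ∫ t in Set.Ici (0 : ℝ), Sum.elim (x t) (q t) ⬝ᵥ Θ *ᵥ Sum.elim (x t) (q t) ≤ 0)
    {ω : ℝ} {x₁ x₂ : Fin n → ℝ} {v₁ v₂ : κ → ℝ}
    (h₁ : A *ᵥ x₁ + b *ᵥ v₁ = -ω • x₂) (h₂ : A *ᵥ x₂ + b *ᵥ v₂ = ω • x₁) :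
    Sum.elim x₁ v₁ ⬝ᵥ Θ *ᵥ Sum.elim x₁ v₁ + Sum.elim x₂ v₂ ⬝ᵥ Θ *ᵥ Sum.elim x₂ v₂ ≤ 0 := by
  obtain ⟨K, hK0, hK⟩ := hA.exists_energy_bound_Ici
  obtain ⟨C, hC0, hC⟩ := exists_bilinear_bound Θ
  set w₁ := Sum.elim x₁ v₁ with hw₁
  set w₂ := Sum.elim x₂ v₂ with hw₂
  set H := w₁ ⬝ᵥ Θ *ᵥ w₁ + w₂ ⬝ᵥ Θ *ᵥ w₂ with hH
  set N := w₁ ⬝ᵥ w₁ + w₂ ⬝ᵥ w₂ with hN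
  set X := x₁ ⬝ᵥ x₁ + x₂ ⬝ᵥ x₂ with hX
  have hn : Sum.elim (-x₁) (-v₁) = -w₁ := by ext k; cases k <;> simp [hw₁]
  -- The signal energies are multiples of 1/(2σ); after multiplication by 2σ the transient
  -- contributes O(σ) for fixed δ. Hence σ → 0 comes first and δ → 0 second.
  have key : ∀ δ σ : ℝ, 0 < δ → 0 < σ →
      H ≤ 2 * δ * N + (2 * C / δ + 1 + C) * K * (2 * σ * X + σ ^ 2 * X) := by
    intro δ σ hδ hσ
    have response : ∀ p r : κ → ℝ, ∃ x : ℝ → Fin n → ℝ, x 0 = 0 ∧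
        IsTrajectory A (fun t => b *ᵥ dampedRotation σ ω p r t) x ∧
        ∫ t in Set.Ici (0 : ℝ), Sum.elim (x t) (dampedRotation σ ω p r t) ⬝ᵥ
          Θ *ᵥ Sum.elim (x t) (dampedRotation σ ω p r t) ≤ 0 := fun p r =>
      ⟨_, by simp, isTrajectory_convolution ((isL2_dampedRotation hσ ω p r).mulVec b),
        h _ _ (isL2_dampedRotation hσ ω p r) rfl⟩
    obtain ⟨y₁, hy₁0, hy₁, hy₁n⟩ := response v₁ v₂
    -- The response to the imaginary part of the same complex input.
    obtain ⟨y₂, hy₂0, hy₂, hy₂n⟩ := response v₂ (-v₁)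
    have h₁' : A *ᵥ x₂ + b *ᵥ v₂ = -ω • -x₁ := by rw [h₂]; simp
    have h₂' : A *ᵥ (-x₁) + b *ᵥ (-v₁) = ω • x₂ := by
      rw [mulVec_neg, mulVec_neg, ← neg_add, h₁]; simp
    have e₁ := integral_dampedRotation_le hΘ hK hC0 hC hA h₁ h₂ hσ hδ hy₁ hy₁0 hy₁n
    have e₂ := integral_dampedRotation_le hΘ hK hC0 hC hA h₁' h₂' hσ hδ hy₂ hy₂0 hy₂n
    rw [hn] at e₂
    classical
    have s1 := integral_dampedRotation_add hσ ω Θ w₁ w₂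
    have s2 := integral_dampedRotation_add hσ ω (1 : Matrix (Fin n ⊕ κ) (Fin n ⊕ κ) ℝ) w₁ w₂
    have s3 := integral_dampedRotation_add hσ ω (1 : Matrix (Fin n) (Fin n) ℝ) x₁ x₂
    simp only [one_mulVec] at s2 s3
    rw [← hH] at s1
    rw [← hN] at s2
    rw [← hX] at s3
    have htot : 1 / (2 * σ) * H ≤ 2 * δ * (1 / (2 * σ) * N)
        + (2 * C / δ + 1 + C) * K * (X + σ ^ 2 * (1 / (2 * σ) * X)) := by
      rw [← s1, ← s2, ← s3, hX]
      linarith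
    have := mul_le_mul_of_nonneg_left htot (by positivity : 0 ≤ 2 * σ)
    refine le_trans (le_of_eq ?_) (this.trans (le_of_eq ?_))
    · field_simp
    · field_simp
  have key2 : ∀ δ : ℝ, 0 < δ → H ≤ 2 * δ * N := by
    intro δ hδ
    have hcont : Continuous fun σ : ℝ =>
        2 * δ * N + (2 * C / δ + 1 + C) * K * (2 * σ * X + σ ^ 2 * X) := by fun_prop
    have ht := (hcont.tendsto 0).mono_left (nhdsWithin_le_nhds (s := Set.Ioi 0))
    have := ge_of_tendsto ht
      (by filter_upwards [self_mem_nhdsWithin] with σ hσ using key δ σ hδ hσ)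
    simpa using this
  have hcont : Continuous fun δ : ℝ => 2 * δ * N := by fun_prop
  have ht := (hcont.tendsto 0).mono_left (nhdsWithin_le_nhds (s := Set.Ioi 0))
  have := ge_of_tendsto ht (by filter_upwards [self_mem_nhdsWithin] with δ hδ using key2 δ hδ)
  simpa using this

end TestSignals

/-! ### Compactness of convex hulls. -/

section ConvexHull

/-- In finite dimension the convex hull of a compact set is compact. -/
lemma isCompact_convexHull {E : Type*} [NormedAddCommGroup E] [NormedSpace ℝ E]
    [FiniteDimensional ℝ E] {s : Set E} (hs : IsCompact s) : IsCompact (convexHull ℝ s) := by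
  rcases s.eq_empty_or_nonempty with rfl | ⟨z₀, hz₀⟩
  · simp
  set N := Module.finrank ℝ E + 1 with hN
  set F : (Fin N → ℝ) × (Fin N → E) → E := fun p => ∑ i, p.1 i • p.2 i with hF
  have hFc : Continuous F := by fun_prop
  have hK : IsCompact (stdSimplex ℝ (Fin N) ×ˢ Set.univ.pi fun _ : Fin N => s) :=
    (isCompact_stdSimplex ℝ (Fin N)).prod (isCompact_univ_pi fun _ => hs)
  convert hK.image hFc
  refine Set.Subset.antisymm (fun x hx => ?_) ?_
  -- Carathéodory: dim + 1 points suffice. Unused indices are padded with weight 0 and the point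
  -- `z₀`.
  · obtain ⟨ι, _, z, w, hz, hind, hw0, hw1, hx⟩ := eq_pos_convex_span_of_mem_convexHull hx
    have hcard : Fintype.card ι ≤ Fintype.card (Fin N) := by
      rw [Fintype.card_fin, hN]
      exact hind.card_le_finrank_succ.trans (Nat.succ_le_succ (Submodule.finrank_le _))
    obtain ⟨e⟩ := Function.Embedding.nonempty_of_card_le hcard
    set w₀ : Fin N → ℝ := fun _ => 0
    have hwe : ∀ i, Function.extend e w w₀ (e i) = w i := e.injective.extend_apply w w₀
    have hw' : ∀ j ∉ Set.range e, Function.extend e w w₀ j = 0 := fun j hj =>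
      Function.extend_apply' w w₀ j hj
    refine ⟨(Function.extend e w w₀, Function.extend e z fun _ => z₀), ⟨⟨fun j => ?_, ?_⟩, ?_⟩, ?_⟩
    · by_cases hj : j ∈ Set.range e
      · obtain ⟨i, rfl⟩ := hj
        simpa only [hwe] using (hw0 i).le
      · simp only [hw' j hj, le_refl]
    · rw [← hw1]
      exact (Fintype.sum_of_injective e e.injective _ _ hw' fun i => (hwe i).symm).symm
    · intro j _
      by_cases hj : j ∈ Set.range e
      · obtain ⟨i, rfl⟩ := hj
        simpa only [e.injective.extend_apply] using hz ⟨i, rfl⟩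
      · simpa only [Function.extend_apply' z (fun _ => z₀) j hj] using hz₀
    · rw [← hx]
      refine (Fintype.sum_of_injective e e.injective _ _ (fun j hj => ?_) fun i => ?_).symm
      · simp only [hw' j hj, zero_smul]
      · simp only [hwe, e.injective.extend_apply]
  · rintro _ ⟨⟨w, z⟩, ⟨⟨hw0, hw1⟩, hz⟩, rfl⟩
    exact mem_convexHull_of_exists_fintype w z hw0 hw1 (fun i => hz i trivial) rfl

end ConvexHull

/-! ### Theorem of alternatives by separation of convex sets. -/

section Separation

variable {n : ℕ} {A : Matrix (Fin n) (Fin n) ℝ} {κ : Type*} [Fintype κ] {b : Matrix (Fin n) κ ℝ}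

/-- The symmetric product `y xᵀ + x yᵀ` paired with storage matrices. -/
def symProd (x y : Fin n → ℝ) : Fin n → Fin n → ℝ := fun i j => y i * x j + x i * y j

/-- Only the symmetric part of the coefficient matrix acts on symmetric products; this makes the
separating functional a storage matrix. -/
lemma exists_symm_matrix_of_strongDual (f : StrongDual ℝ ((Fin n → Fin n → ℝ) × ℝ)) :
    ∃ P : Matrix (Fin n) (Fin n) ℝ, P.IsSymm ∧
      ∀ x y s, f (symProd x y, s) = 2 * (x ⬝ᵥ P *ᵥ y) + f (0, 1) * s := by
  set Q : Matrix (Fin n) (Fin n) ℝ :=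
    Matrix.of fun i j => f (Pi.single i (Pi.single j 1), 0) with hQ
  have hlin : ∀ (H : Fin n → Fin n → ℝ) s, f (H, s) = (∑ i, ∑ j, H i j * Q i j) + f (0, 1) * s := by
    intro H s
    have h1 : (H, s) = (∑ i, ∑ j, H i j • ((Pi.single i (Pi.single j 1) : Fin n → Fin n → ℝ),
        (0 : ℝ))) + s • ((0 : Fin n → Fin n → ℝ), (1 : ℝ)) := by
      refine Prod.ext ?_ ?_
      · ext k l
        simp [Prod.fst_sum, Finset.sum_apply, Pi.single_apply]
      · simp [Prod.snd_sum]
    rw [h1, map_add, map_sum]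
    simp only [map_sum, map_smul, smul_eq_mul, hQ, Matrix.of_apply]
    ring
  refine ⟨(1 / 2 : ℝ) • (Q + Qᵀ), ?_, fun x y s => ?_⟩
  · rw [IsSymm, transpose_smul, transpose_add, transpose_transpose, add_comm]
  · rw [hlin]
    congr 1
    rw [smul_mulVec, dotProduct_smul, smul_eq_mul, ← mul_assoc]
    norm_num
    rw [add_mulVec, dotProduct_add]
    simp only [symProd, dotProduct, mulVec, transpose_apply, Finset.mul_sum, add_mul,
      Finset.sum_add_distrib]
    rw [add_comm]
    congr 1
    · exact Finset.sum_congr rfl fun i _ => Finset.sum_congr rfl fun j _ => by ring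
    · rw [Finset.sum_comm]
      exact Finset.sum_congr rfl fun i _ => Finset.sum_congr rfl fun j _ => by ring

/-- A theorem of alternatives for the linear matrix inequality in the storage matrix. -/
lemma exists_storage_or_certificate (A : Matrix (Fin n) (Fin n) ℝ) (b : Matrix (Fin n) κ ℝ)
    (Θ : Matrix (Fin n ⊕ κ) (Fin n ⊕ κ) ℝ) :
    (∃ P : Matrix (Fin n) (Fin n) ℝ, P.IsSymm ∧ ∀ w : Fin n ⊕ κ → ℝ, w ≠ 0 →
      2 * ((w ∘ Sum.inl) ⬝ᵥ P *ᵥ (A *ᵥ (w ∘ Sum.inl) + b *ᵥ (w ∘ Sum.inr)))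
        + w ⬝ᵥ Θ *ᵥ w < 0) ∨
    ∃ (ι : Type) (_ : Fintype ι) (w : ι → Fin n ⊕ κ → ℝ), (∃ k, w k ≠ 0) ∧
      (∑ k, symProd (w k ∘ Sum.inl) (A *ᵥ (w k ∘ Sum.inl) + b *ᵥ (w k ∘ Sum.inr)) = 0) ∧
      0 ≤ ∑ k, w k ⬝ᵥ Θ *ᵥ w k := by
  set Φ : (Fin n ⊕ κ → ℝ) → (Fin n → Fin n → ℝ) × ℝ := fun w =>
    (symProd (w ∘ Sum.inl) (A *ᵥ (w ∘ Sum.inl) + b *ᵥ (w ∘ Sum.inr)), w ⬝ᵥ Θ *ᵥ w) with hΦ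
  have hΦc : Continuous Φ := by
    have h1 : Continuous fun w : Fin n ⊕ κ → ℝ => w ∘ (Sum.inl : Fin n → Fin n ⊕ κ) :=
      continuous_pi fun i => continuous_apply _
    have h2 : Continuous fun w : Fin n ⊕ κ → ℝ => w ∘ (Sum.inr : κ → Fin n ⊕ κ) :=
      continuous_pi fun i => continuous_apply _
    refine Continuous.prodMk ?_ (by fun_prop)
    refine continuous_pi fun i => continuous_pi fun j => ?_
    simp only [symProd]
    fun_prop
  have hhom : ∀ (c : ℝ) w, Φ (c • w) = c ^ 2 • Φ w := by
    intro c w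
    have e1 : (c • w) ∘ (Sum.inl : Fin n → Fin n ⊕ κ) = c • (w ∘ Sum.inl) := rfl
    have e2 : (c • w) ∘ (Sum.inr : κ → Fin n ⊕ κ) = c • (w ∘ Sum.inr) := rfl
    refine Prod.ext ?_ ?_
    · ext i j
      simp only [hΦ, e1, e2, mulVec_smul, ← smul_add, symProd, Pi.smul_apply, smul_eq_mul,
        Prod.smul_fst]
      ring
    · simp only [hΦ, mulVec_smul, dotProduct_smul, smul_dotProduct, smul_eq_mul, Prod.smul_snd]
      ring
  set S : Set ((Fin n → Fin n → ℝ) × ℝ) := Φ '' Metric.sphere 0 1 with hS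
  have hScomp : IsCompact S := (isCompact_sphere _ _).image hΦc
  -- A point of the convex hull of `S` lying in `T` is exactly a certificate.
  set T : Set ((Fin n → Fin n → ℝ) × ℝ) := {0} ×ˢ Set.Ici 0 with hT
  by_cases hdisj : Disjoint (convexHull ℝ S) T
  · left
    obtain ⟨f, u, v, hfS, huv, hfT⟩ := geometric_hahn_banach_compact_closed (convex_convexHull ℝ S)
      (isCompact_convexHull hScomp) ((convex_singleton _).prod (convex_Ici 0))
      (isClosed_singleton.prod isClosed_Ici) hdisj
    obtain ⟨P, hPs, hP⟩ := exists_symm_matrix_of_strongDual f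
    set τ := f (0, 1) with hτ
    have hv : v < 0 := by
      have := hfT (0, 0) (by simp)
      rwa [Prod.mk_zero_zero, map_zero] at this
    have hτ0 : 0 ≤ τ := by
      by_contra hneg
      push Not at hneg
      have h1 := hfT (0, v / τ) (by
        simp only [Set.mem_prod, Set.mem_singleton_iff, Set.mem_Ici, true_and]
        exact (div_pos_of_neg_of_neg hv hneg).le)
      have h2 : ((0 : Fin n → Fin n → ℝ), v / τ) = (v / τ) • (0, 1) := by simp
      rw [h2, map_smul, ← hτ, smul_eq_mul, div_mul_cancel₀ _ hneg.ne] at h1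
      exact lt_irrefl _ h1
    have hsphere : ∀ w ∈ Metric.sphere (0 : Fin n ⊕ κ → ℝ) 1,
        2 * ((w ∘ Sum.inl) ⬝ᵥ P *ᵥ (A *ᵥ (w ∘ Sum.inl) + b *ᵥ (w ∘ Sum.inr)))
          + τ * (w ⬝ᵥ Θ *ᵥ w) < u := fun w hw => by
      have := hfS _ (subset_convexHull ℝ S ⟨w, hw, rfl⟩)
      rwa [hΦ, hP] at this
    have key : ∃ P' : Matrix (Fin n) (Fin n) ℝ, P'.IsSymm ∧
        ∀ w ∈ Metric.sphere (0 : Fin n ⊕ κ → ℝ) 1,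
        2 * ((w ∘ Sum.inl) ⬝ᵥ P' *ᵥ (A *ᵥ (w ∘ Sum.inl) + b *ᵥ (w ∘ Sum.inr)))
          + w ⬝ᵥ Θ *ᵥ w < 0 := by
      have hu : u < 0 := huv.trans hv
      have hsymm : ∀ c : ℝ, (c • P).IsSymm := fun c => by
        rw [IsSymm, transpose_smul, hPs.eq]
      -- If the weight τ of Θ is zero, `P` alone is uniformly negative on the sphere, and a large
      -- multiple of it dominates Θ; otherwise divide by τ.
      rcases hτ0.eq_or_lt with h0 | hpos
      · obtain ⟨c, hc⟩ := (isCompact_sphere (0 : Fin n ⊕ κ → ℝ) 1).bddAbove_image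
          (f := fun w => w ⬝ᵥ Θ *ᵥ w) (by fun_prop)
        have hu' : u ≠ 0 := hu.ne
        set a := (|c| + 1) / (-u) with ha
        have ha0 : 0 < a := div_pos (by positivity) (neg_pos.mpr hu)
        refine ⟨a • P, hsymm a, fun w hw => ?_⟩
        have h1 := hsphere w hw
        rw [← h0, zero_mul, add_zero] at h1
        have h2 : w ⬝ᵥ Θ *ᵥ w ≤ c := hc ⟨w, hw, rfl⟩
        have h3 := mul_lt_mul_of_pos_left h1 ha0
        have h4 : a * u = -(|c| + 1) := by rw [ha]; field_simp
        rw [smul_mulVec, dotProduct_smul, smul_eq_mul]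
        have := le_abs_self c
        linarith
      · refine ⟨τ⁻¹ • P, hsymm _, fun w hw => ?_⟩
        have h1 := mul_lt_mul_of_pos_left ((hsphere w hw).trans hu) (inv_pos.mpr hpos)
        rw [mul_add, ← mul_assoc τ⁻¹ τ, inv_mul_cancel₀ hpos.ne', mul_zero, one_mul] at h1
        rw [smul_mulVec, dotProduct_smul, smul_eq_mul]
        linarith
    obtain ⟨P', hP's, hP'⟩ := key
    refine ⟨P', hP's, fun w hw => ?_⟩
    have hn : 0 < ‖w‖ := norm_pos_iff.mpr hw
    have h1 := hP' (‖w‖⁻¹ • w) (by simp [norm_smul, inv_mul_cancel₀ hn.ne'])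
    have e1 : (‖w‖⁻¹ • w) ∘ (Sum.inl : Fin n → Fin n ⊕ κ) = ‖w‖⁻¹ • (w ∘ Sum.inl) := rfl
    have e2 : (‖w‖⁻¹ • w) ∘ (Sum.inr : κ → Fin n ⊕ κ) = ‖w‖⁻¹ • (w ∘ Sum.inr) := rfl
    rw [e1, e2] at h1
    simp only [mulVec_smul, ← smul_add, dotProduct_smul, smul_dotProduct, smul_eq_mul] at h1
    have h2 := mul_neg_of_pos_of_neg (pow_pos hn 2) h1
    refine lt_of_eq_of_lt ?_ h2
    field_simp
  · right
    obtain ⟨p, hpS, hpT⟩ := Set.not_disjoint_iff.mp hdisj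
    obtain ⟨ι, hι, a, z, ha0, ha1, hz, hp⟩ := mem_convexHull_iff_exists_fintype.mp hpS
    choose w hw hwz using hz
    -- `Φ` is homogeneous of degree 2, so convex weights enter the vectors as square roots.
    have hsum : ∑ k, Φ (Real.sqrt (a k) • w k) = p := by
      rw [← hp]
      exact Finset.sum_congr rfl fun k _ => by rw [hhom, Real.sq_sqrt (ha0 k), hwz]
    refine ⟨ι, hι, fun k => Real.sqrt (a k) • w k, ?_, ?_, ?_⟩
    · by_contra! hall
      have : ∀ k, a k = 0 := fun k => by
        have hwk : w k ≠ 0 := by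
          intro h0
          have := hw k
          simp [h0] at this
        have := (smul_eq_zero.mp (hall k)).resolve_right hwk
        exact (Real.sqrt_eq_zero (ha0 k)).mp this
      simp [this] at ha1
    · have := congrArg Prod.fst hsum
      rw [Prod.fst_sum, show p.1 = 0 from hpT.1] at this
      exact this
    · have := congrArg Prod.snd hsum
      rw [Prod.snd_sum] at this
      rw [show ∑ k, (Real.sqrt (a k) • w k) ⬝ᵥ Θ *ᵥ (Real.sqrt (a k) • w k) = p.2 from this]
      exact hpT.2

end Separation

/-! ### Unitary factors and their diagonalization. -/

section Unitary

variable {ι μ : Type*} [Fintype ι] [Fintype μ]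

lemma norm_toLp_conjTranspose_mulVec_sq (F : Matrix μ ι ℂ) (x : μ → ℂ) :
    ((‖WithLp.toLp 2 (Fᴴ *ᵥ x)‖ ^ 2 : ℝ) : ℂ) = star x ⬝ᵥ (F * Fᴴ) *ᵥ x := by
  rw [EuclideanSpace.norm_sq_eq, ← mulVec_mulVec, dotProduct_mulVec (star x) F]
  have : star x ᵥ* F = star (Fᴴ *ᵥ x) := by rw [star_mulVec, conjTranspose_conjTranspose]
  rw [this]
  simp only [dotProduct, Pi.star_apply, Complex.ofReal_sum]
  refine Finset.sum_congr rfl fun i _ => ?_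
  rw [← Complex.normSq_eq_norm_sq, Complex.normSq_eq_conj_mul_self]
  rfl

variable [DecidableEq ι]

/-- Two matrices with the same Gram matrix of rows differ by a unitary factor. -/
lemma exists_unitary_of_mul_conjTranspose_eq [DecidableEq μ] {F H : Matrix μ ι ℂ} (h : F * Fᴴ = H * Hᴴ) :
    ∃ U : Matrix ι ι ℂ, Uᴴ * U = 1 ∧ F = H * U := by
  set f := toEuclideanLin Fᴴ with hf
  set g := toEuclideanLin Hᴴ with hg
  have hnorm : ∀ x, ‖f x‖ = ‖g x‖ := by
    intro x
    have h1 := norm_toLp_conjTranspose_mulVec_sq F x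
    have h2 := norm_toLp_conjTranspose_mulVec_sq H x
    rw [h, ← h2] at h1
    have h3 := Complex.ofReal_injective h1
    exact (sq_eq_sq₀ (norm_nonneg _) (norm_nonneg _)).mp h3
  have hker : LinearMap.ker g ≤ LinearMap.ker f := fun x hx => by
    rw [LinearMap.mem_ker] at hx ⊢
    rw [← norm_eq_zero, hnorm, hx, norm_zero]
  -- Equal Gram matrices make Hᴴx ↦ Fᴴx well defined and isometric on the range; it then extends to
  -- an isometry of the whole space.
  set L₀ : LinearMap.range g →ₗ[ℂ] EuclideanSpace ℂ ι :=
    ((LinearMap.ker g).liftQ f hker).comp g.quotKerEquivRange.symm.toLinearMap with hL₀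
  have hL₀g : ∀ x, L₀ ⟨g x, LinearMap.mem_range_self g x⟩ = f x := fun x => by
    have := LinearMap.quotKerEquivRange_symm_apply_image g x (LinearMap.mem_range_self g x)
    simp [hL₀, this]
  set L : LinearMap.range g →ₗᵢ[ℂ] EuclideanSpace ℂ ι :=
    { L₀ with
      norm_map' := by
        rintro ⟨_, x, rfl⟩
        exact (congrArg norm (hL₀g x)).trans (hnorm x) } with hL
  have hLext : ∀ x, L.extend (g x) = f x := fun x =>
    (L.extend_apply ⟨g x, LinearMap.mem_range_self g x⟩).trans (hL₀g x)
  set T : Matrix ι ι ℂ := toEuclideanLin.symm L.extend.toLinearMap with hT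
  have hTapp : ∀ v, toEuclideanLin T v = L.extend v := fun v => by
    rw [hT, LinearEquiv.apply_symm_apply]; rfl
  have hTH : T * Hᴴ = Fᴴ := by
    apply toEuclideanLin.injective
    ext1 x
    have : toEuclideanLin (T * Hᴴ) x = toEuclideanLin T (toEuclideanLin Hᴴ x) := by
      simp
    rw [this, hTapp]
    exact hLext x
  have hTT : Tᴴ * T = 1 := by
    apply toEuclideanLin.injective
    refine LinearMap.ext fun x => ext_inner_left ℂ fun y => ?_
    have : toEuclideanLin (Tᴴ * T) x = toEuclideanLin Tᴴ (toEuclideanLin T x) := by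
      simp
    rw [this, Matrix.toEuclideanLin_conjTranspose_eq_adjoint, LinearMap.adjoint_inner_right,
      hTapp, hTapp, LinearIsometry.inner_map_map]
    simp
  refine ⟨Tᴴ, ?_, ?_⟩
  · rw [conjTranspose_conjTranspose]
    exact mul_eq_one_comm.mp hTT
  · rw [← conjTranspose_conjTranspose F, ← hTH, conjTranspose_mul, conjTranspose_conjTranspose]

/-- Unitary matrices are unitarily diagonalizable. -/
lemma exists_diagonalization_of_unitary {U : Matrix ι ι ℂ} (hU : Uᴴ * U = 1) :
    ∃ (Q : Matrix ι ι ℂ) (d : ι → ℂ), Q * Qᴴ = 1 ∧ (∀ k, ‖d k‖ = 1) ∧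
      U * Q = Q * diagonal d := by
  -- The spectrum is finite and the unit circle is not. With ζ outside the spectrum, the Cayley
  -- transform i(ζ+U)(ζ-U)⁻¹ exists and is Hermitian, so its eigenbasis is available for U.
  obtain ⟨ζ, hζn, hζ⟩ : ∃ ζ : ℂ, ‖ζ‖ = 1 ∧ ζ ∉ spectrum ℂ U := by
    have hinf : (Metric.sphere (0 : ℂ) 1).Infinite := by
      refine (isPreconnected_sphere (by simp [Complex.rank_real_complex]) _ _
        ).infinite_of_nontrivial ⟨1, by simp, -1, by simp, ?_⟩
      norm_num
    obtain ⟨ζ, h1, h2⟩ := (hinf.sdiff U.finite_spectrum).nonempty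
    exact ⟨ζ, by simpa using h1, h2⟩
  have hζζ : star ζ * ζ = 1 := by
    rw [Complex.star_def, ← Complex.normSq_eq_conj_mul_self, Complex.normSq_eq_norm_sq, hζn]; simp
  set N := ζ • (1 : Matrix ι ι ℂ) - U with hN
  have hNu : IsUnit N.det := by
    rw [← Matrix.isUnit_iff_isUnit_det]
    rw [spectrum.notMem_iff, Algebra.algebraMap_eq_smul_one] at hζ
    exact hζ
  set H := Complex.I • ((ζ • (1 : Matrix ι ι ℂ) + U) * N⁻¹) with hH
  have hHN : H * N = Complex.I • (ζ • (1 : Matrix ι ι ℂ) + U) := by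
    rw [hH, smul_mul_assoc, nonsing_inv_mul_cancel_right _ _ hNu]
  -- Congruence with the invertible `N` clears the inverse from the Hermitian symmetry to be
  -- checked.
  have hNH : Nᴴ * (H * N) = Nᴴ * (Hᴴ * N) := by
    have e1 : Nᴴ * (Hᴴ * N) = (H * N)ᴴ * N := by rw [conjTranspose_mul, Matrix.mul_assoc]
    rw [e1, hHN, hN]
    simp only [conjTranspose_smul, conjTranspose_add, conjTranspose_sub, conjTranspose_one,
      Matrix.sub_mul, Matrix.mul_add, Matrix.mul_sub, Matrix.add_mul, smul_mul_assoc,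
      mul_smul_comm, Matrix.mul_one, Matrix.one_mul, hU, smul_sub, smul_add, smul_smul]
    have hI : star Complex.I = -Complex.I := by simp
    have e2 : Complex.I * ζ * star ζ = Complex.I := by linear_combination Complex.I * hζζ
    have e3 : ζ * -(Complex.I * star ζ) = -Complex.I := by linear_combination -Complex.I * hζζ
    have e4 : star ζ * -Complex.I = -(Complex.I * star ζ) := by ring
    have e5 : ζ * -Complex.I = -(Complex.I * ζ) := by ring
    simp only [star_mul, hI, e2, e3, e4, e5, neg_smul]
    abel
  have hHerm : H.IsHermitian := by
    have hNHu : IsUnit (Nᴴ).det := by rw [det_conjTranspose]; exact hNu.star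
    have e1 : H * N = Hᴴ * N := by
      have := congrArg (fun X => (Nᴴ)⁻¹ * X) hNH
      simpa only [nonsing_inv_mul_cancel_left _ _ hNHu] using this
    have := congrArg (fun X => X * N⁻¹) e1
    simp only [mul_nonsing_inv_cancel_right _ _ hNu] at this
    exact this.symm
  set Q : Matrix ι ι ℂ := (hHerm.eigenvectorUnitary : Matrix ι ι ℂ) with hQ
  have hQQ : Q * Qᴴ = 1 := Unitary.coe_mul_star_self hHerm.eigenvectorUnitary
  have hQQ' : Qᴴ * Q = 1 := mul_eq_one_comm.mp hQQ
  set q : ι → ι → ℂ := fun k => Qᵀ k with hq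
  have hq0 : ∀ k, star (q k) ⬝ᵥ q k = 1 := fun k => by
    have := congrFun (congrFun hQQ' k) k
    rw [one_apply_eq] at this
    exact this
  have hHq : ∀ k, H *ᵥ q k = (hHerm.eigenvalues k : ℂ) • q k := fun k => by
    have := hHerm.mulVec_eigenvectorBasis k
    rw [RCLike.real_smul_eq_coe_smul (K := ℂ)] at this
    exact this
  have hHN' : N * H = H * N := by
    have hcomm : N * (ζ • (1 : Matrix ι ι ℂ) + U) = (ζ • (1 : Matrix ι ι ℂ) + U) * N := by
      rw [hN]
      simp only [Matrix.sub_mul, Matrix.mul_add, Matrix.mul_sub, Matrix.add_mul, smul_mul_assoc,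
        mul_smul_comm, Matrix.mul_one, Matrix.one_mul, smul_sub, smul_add]
      abel
    rw [hHN, hH, mul_smul_comm, ← Matrix.mul_assoc, hcomm, mul_nonsing_inv_cancel_right _ _ hNu]
  have hUq : ∀ k, ∃ d : ℂ, U *ᵥ q k = d • q k := by
    intro k
    set h : ℂ := (hHerm.eigenvalues k : ℂ) with hh
    have h1 : (N * H) *ᵥ q k = h • (N *ᵥ q k) := by
      rw [← mulVec_mulVec, hHq, mulVec_smul]
    rw [hHN', hHN, hN] at h1
    simp only [smul_mulVec, add_mulVec, sub_mulVec, one_mulVec, smul_sub, smul_add] at h1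
    have h2 : (Complex.I + h) • (U *ᵥ q k) = ((h - Complex.I) * ζ) • q k := by
      rw [add_smul, mul_smul, sub_smul]
      linear_combination (exp := 1) h1
    -- Eigenvalues of a Hermitian matrix are real.
    have h3 : Complex.I + h ≠ 0 := by
      intro h0
      have := congrArg Complex.im h0
      simp [hh] at this
    refine ⟨(Complex.I + h)⁻¹ * ((h - Complex.I) * ζ), ?_⟩
    rw [mul_smul, ← h2, smul_smul, inv_mul_cancel₀ h3, one_smul]
  choose d hd using hUq
  refine ⟨Q, d, hQQ, fun k => ?_, ?_⟩
  · have h1 : star (U *ᵥ q k) ⬝ᵥ (U *ᵥ q k) = 1 := by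
      rw [star_mulVec, ← dotProduct_mulVec, mulVec_mulVec, hU, one_mulVec, hq0]
    rw [hd, star_smul, smul_dotProduct, dotProduct_smul, hq0] at h1
    simp only [smul_eq_mul, mul_one] at h1
    rw [Complex.star_def, ← Complex.normSq_eq_conj_mul_self, Complex.normSq_eq_norm_sq] at h1
    have h2 : ‖d k‖ ^ 2 = 1 := by exact_mod_cast h1
    exact (pow_eq_one_iff_of_nonneg (norm_nonneg _) two_ne_zero).mp h2
  · ext i k
    rw [mul_diagonal, mul_comm]
    exact congrFun (hd k) i

end Unitary

/-! ### Real coordinates of complex vectors. -/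

section ComplexVectors

variable {α β : Type*}

/-- The entrywise real part of a complex vector. -/
def reVec (v : α → ℂ) : α → ℝ := fun i => (v i).re

/-- The entrywise imaginary part of a complex vector. -/
def imVec (v : α → ℂ) : α → ℝ := fun i => (v i).im

lemma reVec_mulVec [Fintype β] (X : Matrix α β ℝ) (v : β → ℂ) :
    reVec (X.map Complex.ofReal *ᵥ v) = X *ᵥ reVec v := by
  ext i; simp [reVec, mulVec, dotProduct]

lemma imVec_mulVec [Fintype β] (X : Matrix α β ℝ) (v : β → ℂ) :
    imVec (X.map Complex.ofReal *ᵥ v) = X *ᵥ imVec v := by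
  ext i; simp [imVec, mulVec, dotProduct]

lemma eq_zero_of_reVec_imVec {v : α → ℂ} (h₁ : reVec v = 0) (h₂ : imVec v = 0) : v = 0 := by
  ext i
  exact Complex.ext (congrFun h₁ i) (congrFun h₂ i)

lemma re_star_dotProduct [Fintype α] (a c : α → ℂ) :
    (star a ⬝ᵥ c).re = reVec a ⬝ᵥ reVec c + imVec a ⬝ᵥ imVec c := by
  simp [dotProduct, reVec, imVec, Finset.sum_add_distrib]

lemma re_star_dotProduct_mulVec [Fintype α] (Θ : Matrix α α ℝ) (v : α → ℂ) :
    (star v ⬝ᵥ Θ.map Complex.ofReal *ᵥ v).re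
      = reVec v ⬝ᵥ Θ *ᵥ reVec v + imVec v ⬝ᵥ Θ *ᵥ imVec v := by
  rw [re_star_dotProduct, reVec_mulVec, imVec_mulVec]

end ComplexVectors

/-! ### The Kalman-Yakubovich-Popov lemma. -/

section FrequencyDomain

variable {n : ℕ} {A : Matrix (Fin n) (Fin n) ℝ} {κ : Type*} [Fintype κ] {b : Matrix (Fin n) κ ℝ}

/-- The resolvent equation `jω x = A x + g` for real `ω` has a unique solution. -/
lemma IsHurwitz.resolvent_zero (hA : IsHurwitz A) {ω : ℝ} {x₁ x₂ : Fin n → ℝ}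
    (h₁ : A *ᵥ x₁ = -ω • x₂) (h₂ : A *ᵥ x₂ = ω • x₁) : x₁ = 0 ∧ x₂ = 0 := by
  set x : Fin n → ℂ := fun i => ⟨x₁ i, x₂ i⟩ with hx
  have hu := (Matrix.isUnit_iff_isUnit_det _).mp (hA.isUnit_sub (s := Complex.I * ω) (by simp))
  set R := (Complex.I * (ω : ℂ)) • (1 : Matrix (Fin n) (Fin n) ℂ) - A.map Complex.ofReal with hR
  have hRx : R *ᵥ x = 0 := by
    have e1 : reVec (A.map Complex.ofReal *ᵥ x) = -ω • x₂ := by rw [reVec_mulVec]; exact h₁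
    have e2 : imVec (A.map Complex.ofReal *ᵥ x) = ω • x₁ := by rw [imVec_mulVec]; exact h₂
    rw [hR, sub_mulVec, smul_mulVec, one_mulVec, sub_eq_zero]
    ext i
    refine Complex.ext ?_ ?_
    · refine Eq.trans ?_ (congrFun e1 i).symm
      simp [hx]
    · refine Eq.trans ?_ (congrFun e2 i).symm
      simp [hx]
  have hx0 : x = 0 := by
    have := congrArg (fun y => R⁻¹ *ᵥ y) hRx
    simpa [mulVec_mulVec, nonsing_inv_mul _ hu] using this
  exact ⟨funext fun i => congrArg Complex.re (congrFun hx0 i),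
    funext fun i => congrArg Complex.im (congrFun hx0 i)⟩

lemma IsHurwitz.exists_resolvent (hA : IsHurwitz A) (ω : ℝ) (g : Fin n → ℝ) :
    ∃ x₁ x₂ : Fin n → ℝ, A *ᵥ x₁ + g = -ω • x₂ ∧ A *ᵥ x₂ = ω • x₁ := by
  have hu := (Matrix.isUnit_iff_isUnit_det _).mp (hA.isUnit_sub (s := Complex.I * ω) (by simp))
  set R := (Complex.I * (ω : ℂ)) • (1 : Matrix (Fin n) (Fin n) ℂ) - A.map Complex.ofReal with hR
  set x := R⁻¹ *ᵥ fun i => (g i : ℂ) with hx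
  have hRx : (Complex.I * (ω : ℂ)) • x - A.map Complex.ofReal *ᵥ x = fun i => (g i : ℂ) := by
    have : R *ᵥ x = fun i => (g i : ℂ) := by
      rw [hx, mulVec_mulVec, mul_nonsing_inv _ hu, one_mulVec]
    rwa [hR, sub_mulVec, smul_mulVec, one_mulVec] at this
  refine ⟨reVec x, imVec x, ?_, ?_⟩
  · rw [← reVec_mulVec]
    ext i
    have := congrArg Complex.re (congrFun hRx i)
    simp [reVec, imVec] at this ⊢
    linarith
  · rw [← imVec_mulVec]
    ext i
    have := congrArg Complex.im (congrFun hRx i)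
    simp [reVec, imVec] at this ⊢
    linarith

/-- The strict frequency domain inequality in real coordinates. -/
def FreqNeg (A : Matrix (Fin n) (Fin n) ℝ) (b : Matrix (Fin n) κ ℝ)
    (Θ : Matrix (Fin n ⊕ κ) (Fin n ⊕ κ) ℝ) (ε : ℝ) : Prop :=
  ∀ (ω : ℝ) (x₁ x₂ : Fin n → ℝ) (v₁ v₂ : κ → ℝ),
    A *ᵥ x₁ + b *ᵥ v₁ = -ω • x₂ → A *ᵥ x₂ + b *ᵥ v₂ = ω • x₁ →
    Sum.elim x₁ v₁ ⬝ᵥ Θ *ᵥ Sum.elim x₁ v₁ + Sum.elim x₂ v₂ ⬝ᵥ Θ *ᵥ Sum.elim x₂ v₂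
      ≤ -ε * (v₁ ⬝ᵥ v₁ + v₂ ⬝ᵥ v₂)

/-- The limit of the frequency domain inequality at infinite frequency. -/
lemma FreqNeg.at_infinity (hA : IsHurwitz A) {Θ : Matrix (Fin n ⊕ κ) (Fin n ⊕ κ) ℝ}
    (hΘ : Θ.IsSymm) {ε : ℝ} (hF : FreqNeg A b Θ ε) (v : κ → ℝ) :
    Sum.elim 0 v ⬝ᵥ Θ *ᵥ Sum.elim 0 v ≤ -ε * (v ⬝ᵥ v) := by
  obtain ⟨C, hC0, hC⟩ := exists_bilinear_bound Θ
  set e : Fin n ⊕ κ → ℝ := Sum.elim 0 v with he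
  set K := ∑ i, ∑ j, A i j ^ 2 with hK
  set D := 2 * ((b *ᵥ v) ⬝ᵥ (b *ᵥ v)) with hD
  have hee : e ⬝ᵥ e = v ⬝ᵥ v := by simp [he, dotProduct]
  have key : ∀ δ : ℝ, 0 < δ → e ⬝ᵥ Θ *ᵥ e ≤ -ε * (v ⬝ᵥ v) + 2 * δ * (v ⬝ᵥ v) := by
    intro δ hδ
    have hB : ∀ᶠ ω : ℝ in atTop, e ⬝ᵥ Θ *ᵥ e ≤ -ε * (v ⬝ᵥ v) + 2 * δ * (v ⬝ᵥ v)
        + (2 * (C / δ) + 1 + C) * (D / (ω ^ 2 - 2 * K)) := by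
      have hlarge : ∀ᶠ ω : ℝ in atTop, 2 * K < ω ^ 2 :=
        (tendsto_pow_atTop two_ne_zero).eventually_gt_atTop _
      filter_upwards [hlarge] with ω hω
      obtain ⟨x₁, x₂, h₁, h₂⟩ := hA.exists_resolvent ω (b *ᵥ v)
      -- For a fixed input the response decays like 1/ω: comparing norms in jωx = Ax + bv, the
      -- A-terms cost at most 2K|x|².
      have hX : x₁ ⬝ᵥ x₁ + x₂ ⬝ᵥ x₂ ≤ D / (ω ^ 2 - 2 * K) := by
        rw [le_div_iff₀ (by linarith)]
        have m1 := mulVec_dotProduct_self_le A x₁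
        have m2 := mulVec_dotProduct_self_le A x₂
        have e1 : ω ^ 2 * (x₂ ⬝ᵥ x₂) = (A *ᵥ x₁ + b *ᵥ v) ⬝ᵥ (A *ᵥ x₁ + b *ᵥ v) := by
          rw [h₁]; simp only [smul_dotProduct, dotProduct_smul, smul_eq_mul]; ring
        have e2 : ω ^ 2 * (x₁ ⬝ᵥ x₁) = (A *ᵥ x₂) ⬝ᵥ (A *ᵥ x₂) := by
          rw [h₂]; simp only [smul_dotProduct, dotProduct_smul, smul_eq_mul]; ring
        have e3 : (A *ᵥ x₁ + b *ᵥ v) ⬝ᵥ (A *ᵥ x₁ + b *ᵥ v)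
            ≤ 2 * ((A *ᵥ x₁) ⬝ᵥ (A *ᵥ x₁)) + D := by
          have := dotProduct_self_nonneg_real (A *ᵥ x₁ - b *ᵥ v)
          simp only [sub_dotProduct, dotProduct_sub, add_dotProduct, dotProduct_add] at this ⊢
          linarith
        have hK0 : 0 ≤ K := by positivity
        have := mul_nonneg hK0 (dotProduct_self_nonneg_real x₂)
        rw [← hK] at m1 m2
        nlinarith
      have hf := hF ω x₁ x₂ v 0 h₁ (by rw [mulVec_zero, add_zero]; exact h₂)
      rw [dotProduct_zero, add_zero] at hf
      have e1 : Sum.elim x₁ v = e + Sum.elim x₁ 0 := by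
        ext k; cases k <;> simp [he]
      set g : Fin n ⊕ κ → ℝ := Sum.elim x₁ 0 with hg
      set g₂ : Fin n ⊕ κ → ℝ := Sum.elim x₂ 0 with hg₂
      have hgg : g ⬝ᵥ g = x₁ ⬝ᵥ x₁ := by simp [hg, dotProduct]
      have hgg₂ : g₂ ⬝ᵥ g₂ = x₂ ⬝ᵥ x₂ := by simp [hg₂, dotProduct]
      rw [e1] at hf
      have b1 := (abs_le.mp (hC δ hδ e g)).1
      have b2 := (abs_le.mp (hC 1 one_pos g g)).1
      have b3 := (abs_le.mp (hC 1 one_pos g₂ g₂)).1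
      simp only [mulVec_add, dotProduct_add, add_dotProduct, dotProduct_mulVec_symm hΘ g e] at hf
      rw [div_one, hgg] at b2
      rw [div_one, hgg₂] at b3
      rw [hgg, hee] at b1
      have hcoef : 0 ≤ 2 * (C / δ) + 1 + C := by positivity
      have := mul_le_mul_of_nonneg_left hX hcoef
      have hCd : 0 ≤ C / δ := by positivity
      have := mul_nonneg hCd (dotProduct_self_nonneg_real x₂)
      nlinarith
    have ht : Tendsto (fun ω : ℝ => -ε * (v ⬝ᵥ v) + 2 * δ * (v ⬝ᵥ v)
        + (2 * (C / δ) + 1 + C) * (D / (ω ^ 2 - 2 * K))) atTop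
        (𝓝 (-ε * (v ⬝ᵥ v) + 2 * δ * (v ⬝ᵥ v) + (2 * (C / δ) + 1 + C) * 0)) := by
      refine Tendsto.const_add _ (Tendsto.const_mul _ ?_)
      exact Tendsto.const_div_atTop (tendsto_atTop_add_const_right _ _
        (tendsto_pow_atTop two_ne_zero)) _
    have := ge_of_tendsto ht hB
    linarith
  have hcont : Continuous fun δ : ℝ => -ε * (v ⬝ᵥ v) + 2 * δ * (v ⬝ᵥ v) := by fun_prop
  have ht := (hcont.tendsto 0).mono_left (nhdsWithin_le_nhds (s := Set.Ioi 0))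
  have := ge_of_tendsto ht (by filter_upwards [self_mem_nhdsWithin] with δ hδ using key δ hδ)
  simpa using this

/-- A complex vector on the extended imaginary axis pencil satisfies the strict inequality. -/
lemma FreqNeg.re_neg (hA : IsHurwitz A) {Θ : Matrix (Fin n ⊕ κ) (Fin n ⊕ κ) ℝ}
    (hΘ : Θ.IsSymm) {ε : ℝ} (hε : 0 < ε) (hF : FreqNeg A b Θ ε) {w : Fin n ⊕ κ → ℂ} (hw : w ≠ 0)
    {d : ℂ} (hd : ‖d‖ = 1)
    (h : A.map Complex.ofReal *ᵥ (w ∘ Sum.inl) + b.map Complex.ofReal *ᵥ (w ∘ Sum.inr)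
        + w ∘ Sum.inl
      = d • (A.map Complex.ofReal *ᵥ (w ∘ Sum.inl) + b.map Complex.ofReal *ᵥ (w ∘ Sum.inr)
        - w ∘ Sum.inl)) :
    reVec w ⬝ᵥ Θ *ᵥ reVec w + imVec w ⬝ᵥ Θ *ᵥ imVec w < 0 := by
  set x := w ∘ Sum.inl with hx
  set v := w ∘ Sum.inr with hv
  set y := A.map Complex.ofReal *ᵥ x + b.map Complex.ofReal *ᵥ v with hy
  have hre : reVec w = Sum.elim (reVec x) (reVec v) := by ext k; cases k <;> rfl
  have him : imVec w = Sum.elim (imVec x) (imVec v) := by ext k; cases k <;> rfl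
  have hyre : A *ᵥ reVec x + b *ᵥ reVec v = reVec y := by
    rw [← reVec_mulVec, ← reVec_mulVec]; rfl
  have hyim : A *ᵥ imVec x + b *ᵥ imVec v = imVec y := by
    rw [← imVec_mulVec, ← imVec_mulVec]; rfl
  have hwxv : x = 0 → v ≠ 0 := by
    rintro hx0 hv0
    apply hw
    ext k
    cases k with
    | inl i => exact congrFun hx0 i
    | inr i => exact congrFun hv0 i
  have hpos : v ≠ 0 → 0 < reVec v ⬝ᵥ reVec v + imVec v ⬝ᵥ imVec v := by
    intro hv0
    have h1 := dotProduct_self_nonneg_real (reVec v)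
    have h2 := dotProduct_self_nonneg_real (imVec v)
    by_cases hr : reVec v = 0
    · have hi : imVec v ≠ 0 := fun hi => hv0 (eq_zero_of_reVec_imVec hr hi)
      linarith [dotProduct_self_pos_real hi]
    · linarith [dotProduct_self_pos_real hr]
  rw [hre, him]
  -- d = 1 is the point at infinity of the imaginary axis: it forces x = 0.
  by_cases hd1 : d = 1
  · have hx0 : x = 0 := by
      rw [hd1, one_smul] at h
      have : (2 : ℂ) • x = 0 := by
        rw [two_smul]
        linear_combination (exp := 1) h
      simpa using this
    have hr0 : reVec x = 0 := by rw [hx0]; rfl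
    have hi0 : imVec x = 0 := by rw [hx0]; rfl
    rw [hr0, hi0]
    have h1 := hF.at_infinity hA hΘ (reVec v)
    have h2 := hF.at_infinity hA hΘ (imVec v)
    have := mul_pos hε (hpos (hwxv hx0))
    linarith
  · have hsub : d - 1 ≠ 0 := sub_ne_zero.mpr hd1
    set c := (d + 1) / (d - 1) with hc
    have hyx : y = c • x := by
      have h1 : (d - 1) • y = (d + 1) • x := by
        rw [smul_sub] at h
        rw [sub_smul, add_smul, one_smul, one_smul]
        linear_combination (exp := 1) -h
      rw [hc, div_eq_inv_mul, mul_smul, ← h1, smul_smul, inv_mul_cancel₀ hsub, one_smul]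
    -- The real part of (d+1)/(d-1) is (|d|² - 1)/|d - 1|², so |d| = 1 yields a genuine frequency.
    have hcre : c.re = 0 := by
      have hn : d.re * d.re + d.im * d.im = 1 := by
        rw [← Complex.normSq_apply, Complex.normSq_eq_norm_sq, hd, one_pow]
      rw [hc, Complex.div_re, ← add_div]
      simp only [Complex.add_re, Complex.one_re, Complex.sub_re, Complex.add_im, Complex.one_im,
        Complex.sub_im]
      rw [div_eq_zero_iff]
      left
      linarith
    have h1 : A *ᵥ reVec x + b *ᵥ reVec v = -c.im • imVec x := by
      rw [hyre, hyx]
      ext i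
      simp [reVec, imVec, hcre]
    have h2 : A *ᵥ imVec x + b *ᵥ imVec v = c.im • reVec x := by
      rw [hyim, hyx]
      ext i
      simp [reVec, imVec, hcre]
    -- With v = 0, a nonzero x would be an eigenvector of A on the imaginary axis.
    have hv0 : v ≠ 0 := by
      intro hv0
      have hr0 : reVec v = 0 := by rw [hv0]; rfl
      have hi0 : imVec v = 0 := by rw [hv0]; rfl
      rw [hr0, mulVec_zero, add_zero] at h1
      rw [hi0, mulVec_zero, add_zero] at h2
      obtain ⟨h3, h4⟩ := hA.resolvent_zero h1 h2
      exact hwxv (eq_zero_of_reVec_imVec h3 h4) hv0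
    have h3 := hF c.im _ _ _ _ h1 h2
    have := mul_pos hε (hpos hv0)
    linarith

/-- The sum of the values of a quadratic form on the columns of a matrix is unitarily invariant. -/
lemma sum_quadratic_mul_unitary {α ι : Type*} [Fintype α] [Fintype ι] [DecidableEq ι]
    (Θ : Matrix α α ℝ) (w : ι → α → ℝ) {Q : Matrix ι ι ℂ} (hQ : Q * Qᴴ = 1) :
    ∑ k, w k ⬝ᵥ Θ *ᵥ w k = ∑ k, (reVec (fun i => ∑ l, (w l i : ℂ) * Q l k) ⬝ᵥ
        Θ *ᵥ reVec (fun i => ∑ l, (w l i : ℂ) * Q l k)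
      + imVec (fun i => ∑ l, (w l i : ℂ) * Q l k) ⬝ᵥ
        Θ *ᵥ imVec (fun i => ∑ l, (w l i : ℂ) * Q l k)) := by
  set Wc : Matrix α ι ℂ := Matrix.of fun i l => (w l i : ℂ) with hWc
  set Θc := Θ.map Complex.ofReal with hΘc
  have e0 : ∀ k, (fun i => ∑ l, (w l i : ℂ) * Q l k) = (Wc * Q)ᵀ k := fun k => by
    ext i; simp [hWc, Matrix.mul_apply]
  have ht : ∀ Y : Matrix α ι ℂ, (Yᴴ * Θc * Y).trace = ∑ k, star (Yᵀ k) ⬝ᵥ Θc *ᵥ Yᵀ k := by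
    intro Y
    rw [Matrix.trace]
    refine Finset.sum_congr rfl fun k _ => ?_
    rw [diag_apply, Matrix.mul_assoc]
    simp only [Matrix.mul_apply, dotProduct, mulVec, conjTranspose_apply, transpose_apply,
      Pi.star_apply]
  have h1 : ((Wc * Q)ᴴ * Θc * (Wc * Q)).trace = (Wcᴴ * Θc * Wc).trace := by
    rw [conjTranspose_mul]
    have : Qᴴ * Wcᴴ * Θc * (Wc * Q) = Qᴴ * (Wcᴴ * Θc * Wc * Q) := by
      simp only [Matrix.mul_assoc]
    rw [this, trace_mul_comm, Matrix.mul_assoc, hQ, Matrix.mul_one]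
  have h2 := congrArg Complex.re h1
  rw [ht, ht, Complex.re_sum, Complex.re_sum] at h2
  simp only [e0, ← re_star_dotProduct_mulVec]
  rw [h2]
  refine Finset.sum_congr rfl fun k _ => ?_
  rw [re_star_dotProduct_mulVec]
  have r1 : reVec (Wcᵀ k) = w k := by ext i; simp [reVec, hWc]
  have r2 : imVec (Wcᵀ k) = 0 := by ext i; simp [imVec, hWc]
  rw [r1, r2, zero_dotProduct, add_zero]

/-- The Kalman-Yakubovich-Popov lemma for a Hurwitz matrix: the strict frequency domain inequality
provides a storage matrix. -/
theorem FreqNeg.exists_storage (hA : IsHurwitz A) {Θ : Matrix (Fin n ⊕ κ) (Fin n ⊕ κ) ℝ}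
    (hΘ : Θ.IsSymm) {ε : ℝ} (hε : 0 < ε) (hF : FreqNeg A b Θ ε) :
    ∃ P : Matrix (Fin n) (Fin n) ℝ, P.IsSymm ∧ ∀ w : Fin n ⊕ κ → ℝ, w ≠ 0 →
      2 * ((w ∘ Sum.inl) ⬝ᵥ P *ᵥ (A *ᵥ (w ∘ Sum.inl) + b *ᵥ (w ∘ Sum.inr)))
        + w ⬝ᵥ Θ *ᵥ w < 0 := by
  classical
  refine (exists_storage_or_certificate A b Θ).resolve_right ?_
  rintro ⟨ι, _, w, ⟨k₀, hk₀⟩, hsum, hnonneg⟩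
  set x : ι → Fin n → ℝ := fun k => w k ∘ Sum.inl with hx
  set y : ι → Fin n → ℝ := fun k => A *ᵥ (w k ∘ Sum.inl) + b *ᵥ (w k ∘ Sum.inr) with hy
  set F : Matrix (Fin n) ι ℂ := Matrix.of fun i k => ((y k i + x k i : ℝ) : ℂ) with hFdef
  set H : Matrix (Fin n) ι ℂ := Matrix.of fun i k => ((y k i - x k i : ℝ) : ℂ) with hHdef
  -- The difference of the two Gram matrices is twice the vanishing sum of symmetric products.
  have hFH : F * Fᴴ = H * Hᴴ := by
    ext i j
    have h1 := congrFun (congrFun hsum i) j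
    simp only [Finset.sum_apply, symProd, Pi.zero_apply] at h1
    simp only [Matrix.mul_apply, conjTranspose_apply, hFdef, hHdef, Matrix.of_apply,
      Complex.star_def, Complex.conj_ofReal]
    have h2 : ∑ k, (y k i + x k i) * (y k j + x k j) = ∑ k, (y k i - x k i) * (y k j - x k j) := by
      rw [← sub_eq_zero, ← Finset.sum_sub_distrib]
      have h3 : ∀ k, (y k i + x k i) * (y k j + x k j) - (y k i - x k i) * (y k j - x k j)
          = 2 * (y k i * x k j + x k i * y k j) := fun k => by ring
      simp only [h3, ← Finset.mul_sum]
      rw [h1, mul_zero]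
    exact_mod_cast h2
  obtain ⟨U, hU, hFU⟩ := exists_unitary_of_mul_conjTranspose_eq hFH
  obtain ⟨Q, d, hQ, hd, hUQ⟩ := exists_diagonalization_of_unitary hU
  set z : ι → Fin n ⊕ κ → ℂ := fun k i => ∑ l, (w l i : ℂ) * Q l k with hz
  have hFQ : F * Q = H * Q * diagonal d := by
    rw [hFU, Matrix.mul_assoc, hUQ, Matrix.mul_assoc]
  have hyz : ∀ k, A.map Complex.ofReal *ᵥ (z k ∘ Sum.inl) + b.map Complex.ofReal *ᵥ (z k ∘ Sum.inr)
      = fun i => ∑ l, (y l i : ℂ) * Q l k := by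
    intro k
    ext i
    simp only [Pi.add_apply, mulVec, dotProduct, hz, hy, Function.comp, Matrix.map_apply,
      Finset.mul_sum, Complex.ofReal_add, Complex.ofReal_sum, Complex.ofReal_mul, add_mul,
      Finset.sum_add_distrib, Finset.sum_mul]
    congr 1 <;>
    · rw [Finset.sum_comm]
      exact Finset.sum_congr rfl fun l _ => Finset.sum_congr rfl fun j _ => by ring
  have hpencil : ∀ k, A.map Complex.ofReal *ᵥ (z k ∘ Sum.inl)
        + b.map Complex.ofReal *ᵥ (z k ∘ Sum.inr) + z k ∘ Sum.inl
      = d k • (A.map Complex.ofReal *ᵥ (z k ∘ Sum.inl) + b.map Complex.ofReal *ᵥ (z k ∘ Sum.inr)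
        - z k ∘ Sum.inl) := by
    intro k
    rw [hyz]
    ext i
    have h1 := congrFun (congrFun hFQ i) k
    rw [mul_diagonal] at h1
    simp only [Matrix.mul_apply, hFdef, hHdef, Matrix.of_apply, Complex.ofReal_add,
      Complex.ofReal_sub, add_mul, sub_mul, Finset.sum_add_distrib, Finset.sum_sub_distrib] at h1
    simp only [Pi.add_apply, Pi.smul_apply, Pi.sub_apply, smul_eq_mul, Function.comp, hz]
    rw [mul_comm (d k), sub_mul]
    exact h1
  have hterm : ∀ k, z k ≠ 0 → reVec (z k) ⬝ᵥ Θ *ᵥ reVec (z k) + imVec (z k) ⬝ᵥ Θ *ᵥ imVec (z k) < 0 :=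
    fun k hk => hF.re_neg hA hΘ hε hk (hd k) (hpencil k)
  have hterm' : ∀ k, reVec (z k) ⬝ᵥ Θ *ᵥ reVec (z k) + imVec (z k) ⬝ᵥ Θ *ᵥ imVec (z k) ≤ 0 := by
    intro k
    by_cases hk : z k = 0
    · have h1 : reVec (z k) = 0 := by rw [hk]; rfl
      have h2 : imVec (z k) = 0 := by rw [hk]; rfl
      rw [h1, h2]; simp
    · exact (hterm k hk).le
  -- `Q` is invertible, so the combined vectors cannot all vanish.
  have hex : ∃ k, z k ≠ 0 := by
    by_contra! hall
    apply hk₀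
    ext i
    have h1 : ∀ l, (w l i : ℂ) = ∑ k, z k i * Qᴴ k l := by
      intro l
      have h2 : ∑ k, z k i * Qᴴ k l = ∑ m, (w m i : ℂ) * (Q * Qᴴ) m l := by
        simp only [hz, Finset.sum_mul, Matrix.mul_apply, Finset.mul_sum]
        rw [Finset.sum_comm]
        exact Finset.sum_congr rfl fun _ _ => Finset.sum_congr rfl fun _ _ => by ring
      rw [h2, hQ]
      simp [Matrix.one_apply]
    have h3 := h1 k₀
    simp only [hall, Pi.zero_apply, zero_mul, Finset.sum_const_zero] at h3
    exact_mod_cast h3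
  obtain ⟨k, hk⟩ := hex
  rw [sum_quadratic_mul_unitary Θ w hQ] at hnonneg
  have := Finset.sum_lt_sum (fun k _ => hterm' k) ⟨k, Finset.mem_univ k, hterm k hk⟩
  rw [Finset.sum_const_zero] at this
  exact absurd hnonneg (not_le.mpr this)

end FrequencyDomain

lemma sumElim_dotProduct {α β : Type*} [Fintype α] [Fintype β] (a a' : α → ℝ) (c c' : β → ℝ) :
    Sum.elim a c ⬝ᵥ Sum.elim a' c' = a ⬝ᵥ a' + c ⬝ᵥ c' := by
  simp [dotProduct]

/-! ### The multiplier form pointwise and integrated. -/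

section Multiplier

variable {n m : ℕ} (lam lo hi : Fin m → Fin n → ℝ)

lemma isSymm_M : (M lam lo hi).IsSymm := by
  rw [IsSymm, M, fromBlocks_transpose, diagonal_transpose, diagonal_transpose,
    transpose_transpose]

lemma dotProduct_U_mulVec (x : Fin n → ℝ) (u : Fin m × Fin n → ℝ) :
    x ⬝ᵥ U lam lo hi *ᵥ u = ∑ i, ∑ j, lam i j * center lo hi i j * u (i, j) * x j := by
  simp only [dotProduct, mulVec, U, Matrix.of_apply, Fintype.sum_prod_type, Finset.mul_sum]
  rw [Finset.sum_comm]
  refine Finset.sum_congr rfl fun i _ => ?_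
  rw [Finset.sum_comm]
  refine Finset.sum_congr rfl fun j _ => ?_
  simp only [ite_mul, zero_mul, mul_ite, mul_zero, Finset.sum_ite_eq', Finset.mem_univ, if_true]
  ring

lemma quadratic_M (x : Fin n → ℝ) (u : Fin m × Fin n → ℝ) :
    Sum.elim x u ⬝ᵥ M lam lo hi *ᵥ Sum.elim x u
      = ∑ i, ∑ j, lam i j * ((radius lo hi i j ^ 2 - center lo hi i j ^ 2) * (x j * x j)
          + 2 * center lo hi i j * (u (i, j) * x j) - u (i, j) * u (i, j)) := by
  have h1 : x ⬝ᵥ (diagonal fun j =>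
      ∑ i, lam i j * ((radius lo hi i j) ^ 2 - (center lo hi i j) ^ 2)) *ᵥ x
      = ∑ i, ∑ j, lam i j * (radius lo hi i j ^ 2 - center lo hi i j ^ 2) * (x j * x j) := by
    simp only [dotProduct, mulVec_diagonal, Finset.sum_mul, Finset.mul_sum]
    rw [Finset.sum_comm]
    exact Finset.sum_congr rfl fun i _ => Finset.sum_congr rfl fun j _ => by ring
  have h2 : u ⬝ᵥ (U lam lo hi)ᵀ *ᵥ x = x ⬝ᵥ U lam lo hi *ᵥ u := by
    rw [dotProduct_mulVec, vecMul_transpose, dotProduct_comm]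
  have h3 : u ⬝ᵥ (diagonal fun k : Fin m × Fin n => -lam k.1 k.2) *ᵥ u
      = ∑ i, ∑ j, -lam i j * (u (i, j) * u (i, j)) := by
    simp only [dotProduct, mulVec_diagonal, Fintype.sum_prod_type]
    exact Finset.sum_congr rfl fun i _ => Finset.sum_congr rfl fun j _ => by ring
  rw [M, fromBlocks_mulVec, Sum.elim_comp_inl, Sum.elim_comp_inr, sumElim_dotProduct,
    dotProduct_add, dotProduct_add, h1, h2, h3, dotProduct_U_mulVec]
  simp only [← Finset.sum_add_distrib]
  exact Finset.sum_congr rfl fun i _ => Finset.sum_congr rfl fun j _ => by ring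

lemma sigNormSq_eq_integral {ι : Type*} [Fintype ι] {q : ℝ → ι → ℝ} (hq : IsL2 q) :
    sigNormSq q = ∫ t in Set.Ici (0 : ℝ), q t ⬝ᵥ q t := by
  simp only [sigNormSq, sigInner, dotProduct]
  exact (integral_finsetSum _ fun k _ => MemLp.integrable_mul (hq k) (hq k)).symm

lemma sum_phi_eq_integral {x : ℝ → Fin n → ℝ} {q : ℝ → Fin m × Fin n → ℝ} (hx : IsL2 x)
    (hq : IsL2 q) :
    ∑ i, ∑ j, lam i j * phi lo hi i j x q
      = ∫ t in Set.Ici (0 : ℝ), Sum.elim (x t) (q t) ⬝ᵥ M lam lo hi *ᵥ Sum.elim (x t) (q t) := by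
  have i1 : ∀ i j, Integrable (fun t => (radius lo hi i j ^ 2 - center lo hi i j ^ 2)
      * (x t j * x t j)) (volume.restrict (Set.Ici 0)) := fun i j =>
    (MemLp.integrable_mul (hx j) (hx j)).const_mul _
  have i2 : ∀ i j, Integrable (fun t => 2 * center lo hi i j * (q t (i, j) * x t j))
      (volume.restrict (Set.Ici 0)) := fun i j =>
    (MemLp.integrable_mul (hq (i, j)) (hx j)).const_mul _
  have i3 : ∀ i j, Integrable (fun t => q t (i, j) * q t (i, j))
      (volume.restrict (Set.Ici 0)) := fun i j => MemLp.integrable_mul (hq (i, j)) (hq (i, j))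
  have i4 : ∀ i j, Integrable (fun t => lam i j * ((radius lo hi i j ^ 2 - center lo hi i j ^ 2)
      * (x t j * x t j) + 2 * center lo hi i j * (q t (i, j) * x t j) - q t (i, j) * q t (i, j)))
      (volume.restrict (Set.Ici 0)) := fun i j =>
    (((i1 i j).add (i2 i j)).sub (i3 i j)).const_mul _
  simp only [quadratic_M]
  rw [integral_finsetSum _ fun i _ => integrable_finsetSum _ fun j _ => i4 i j]
  refine Finset.sum_congr rfl fun i _ => ?_
  rw [integral_finsetSum _ fun j _ => i4 i j]
  refine Finset.sum_congr rfl fun j _ => ?_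
  have e1 := integral_sub ((i1 i j).add (i2 i j)) (i3 i j)
  have e2 := integral_add (i1 i j) (i2 i j)
  simp only [Pi.add_apply] at e1
  rw [integral_const_mul, e1, e2, integral_const_mul, integral_const_mul]
  rfl

end Multiplier

/-! ### SDP, storage, multiplier and frequency conditions. -/

section Equivalences

variable {n m : ℕ} {A : Matrix (Fin n) (Fin n) ℝ} {B : Matrix (Fin n) (Fin m) ℝ}
  {lo hi : Fin m → Fin n → ℝ}

lemma isTrajectory_G {q : ℝ → Fin m × Fin n → ℝ} (hq : IsL2 q) :
    IsTrajectory A (fun t => (B * W m n) *ᵥ q t) (G A B q) :=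
  isTrajectory_convolution (hq.mulVec (B * W m n))

lemma isL2_G (hA : IsHurwitz A) {q : ℝ → Fin m × Fin n → ℝ} (hq : IsL2 q) : IsL2 (G A B q) :=
  (isTrajectory_G hq).isL2 hA (hq.mulVec (B * W m n))

/-- The strict Kalman-Yakubovich-Popov inequality for the multiplier `lam`. -/
def StorageIneq (A : Matrix (Fin n) (Fin n) ℝ) (B : Matrix (Fin n) (Fin m) ℝ)
    (lo hi : Fin m → Fin n → ℝ) (P : Matrix (Fin n) (Fin n) ℝ) (lam : Fin m → Fin n → ℝ) : Prop :=
  ∀ w : Fin n ⊕ (Fin m × Fin n) → ℝ, w ≠ 0 →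
    2 * ((w ∘ Sum.inl) ⬝ᵥ P *ᵥ (A *ᵥ (w ∘ Sum.inl) + (B * W m n) *ᵥ (w ∘ Sum.inr)))
      + w ⬝ᵥ M lam lo hi *ᵥ w < 0

/-- The matrix of the quadratic form of the strict Kalman-Yakubovich-Popov inequality. -/
noncomputable def storageMatrix (A : Matrix (Fin n) (Fin n) ℝ) (B : Matrix (Fin n) (Fin m) ℝ)
    (lo hi : Fin m → Fin n → ℝ) (P : Matrix (Fin n) (Fin n) ℝ) (lam : Fin m → Fin n → ℝ) :
    Matrix (Fin n ⊕ (Fin m × Fin n)) (Fin n ⊕ (Fin m × Fin n)) ℝ :=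
  fromBlocks (Aᵀ * P + P * A) (P * B * W m n) ((W m n)ᵀ * Bᵀ * P) 0 + M lam lo hi

lemma quadratic_storageMatrix {P : Matrix (Fin n) (Fin n) ℝ} (hP : P.IsSymm)
    (lam : Fin m → Fin n → ℝ) (w : Fin n ⊕ (Fin m × Fin n) → ℝ) :
    w ⬝ᵥ storageMatrix A B lo hi P lam *ᵥ w
      = 2 * ((w ∘ Sum.inl) ⬝ᵥ P *ᵥ (A *ᵥ (w ∘ Sum.inl) + (B * W m n) *ᵥ (w ∘ Sum.inr)))
      + w ⬝ᵥ M lam lo hi *ᵥ w := by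
  rw [storageMatrix, add_mulVec, dotProduct_add]
  congr 1
  set x := w ∘ Sum.inl with hx
  set u := w ∘ Sum.inr with hu
  have hw : w = Sum.elim x u := by ext k; cases k <;> rfl
  have e1 : x ⬝ᵥ Aᵀ *ᵥ (P *ᵥ x) = x ⬝ᵥ P *ᵥ (A *ᵥ x) := by
    rw [dotProduct_mulVec, vecMul_transpose, dotProduct_mulVec_symm hP]
  have e2 : u ⬝ᵥ ((W m n)ᵀ * Bᵀ * P) *ᵥ x = x ⬝ᵥ P *ᵥ ((B * W m n) *ᵥ u) := by
    rw [← transpose_mul, ← mulVec_mulVec, dotProduct_mulVec, vecMul_transpose,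
      dotProduct_mulVec_symm hP]
  conv_lhs => rw [hw]
  rw [fromBlocks_mulVec, Sum.elim_comp_inl, Sum.elim_comp_inr, sumElim_dotProduct, zero_mulVec,
    add_zero, dotProduct_add, add_mulVec, dotProduct_add, ← mulVec_mulVec, ← mulVec_mulVec, e1, e2,
    Matrix.mul_assoc P, ← mulVec_mulVec, mulVec_add, dotProduct_add]
  ring

lemma StorageIneq.exists_bound {P : Matrix (Fin n) (Fin n) ℝ} (hP : P.IsSymm)
    {lam : Fin m → Fin n → ℝ} (h : StorageIneq A B lo hi P lam) :
    ∃ ε : ℝ, 0 < ε ∧ ∀ w : Fin n ⊕ (Fin m × Fin n) → ℝ,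
      2 * ((w ∘ Sum.inl) ⬝ᵥ P *ᵥ (A *ᵥ (w ∘ Sum.inl) + (B * W m n) *ᵥ (w ∘ Sum.inr)))
      + w ⬝ᵥ M lam lo hi *ᵥ w ≤ -ε * (w ⬝ᵥ w) := by
  obtain ⟨ε, hε, hb⟩ := exists_neg_bound (storageMatrix A B lo hi P lam) fun w hw => by
    rw [quadratic_storageMatrix hP]; exact h w hw
  exact ⟨ε, hε, fun w => by rw [← quadratic_storageMatrix hP]; exact hb w⟩

lemma quadratic_sdpMatrix {P : Matrix (Fin n) (Fin n) ℝ} (hP : P.IsSymm)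
    (lam : Fin m → Fin n → ℝ) (γ : ℝ) (w : Fin n ⊕ (Fin m × Fin n) → ℝ) (p : Fin m → ℝ) :
    Sum.elim w p ⬝ᵥ sdpMatrix A B lo hi P lam γ *ᵥ Sum.elim w p
      = 2 * ((w ∘ Sum.inl) ⬝ᵥ P *ᵥ (A *ᵥ (w ∘ Sum.inl) + (B * W m n) *ᵥ (w ∘ Sum.inr)))
      + w ⬝ᵥ M lam lo hi *ᵥ w + 1 / γ * ((w ∘ Sum.inl) ⬝ᵥ (w ∘ Sum.inl))
      + 2 * ((w ∘ Sum.inl) ⬝ᵥ (P * B) *ᵥ p) - γ * (p ⬝ᵥ p) := by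
  have hO : w ⬝ᵥ blockO A B lo hi P lam γ *ᵥ w
      = 2 * ((w ∘ Sum.inl) ⬝ᵥ P *ᵥ (A *ᵥ (w ∘ Sum.inl) + (B * W m n) *ᵥ (w ∘ Sum.inr)))
      + w ⬝ᵥ M lam lo hi *ᵥ w + 1 / γ * ((w ∘ Sum.inl) ⬝ᵥ (w ∘ Sum.inl)) := by
    have e : blockO A B lo hi P lam γ
        = storageMatrix A B lo hi P lam + (1 / γ) • fromBlocks 1 0 0 0 := by
      rw [blockO, storageMatrix]; abel
    rw [e, add_mulVec, dotProduct_add, quadratic_storageMatrix hP, smul_mulVec, dotProduct_smul,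
      smul_eq_mul, fromBlocks_mulVec]
    have hw : w = Sum.elim (w ∘ Sum.inl) (w ∘ Sum.inr) := by ext k; cases k <;> rfl
    congr 2
    conv_lhs => rw [hw]
    rw [sumElim_dotProduct]
    simp
  have hS : w ⬝ᵥ blockS B P *ᵥ p = (w ∘ Sum.inl) ⬝ᵥ (P * B) *ᵥ p := by
    have hw : w = Sum.elim (w ∘ Sum.inl) (w ∘ Sum.inr) := by ext k; cases k <;> rfl
    rw [blockS, fromRows_mulVec]
    conv_lhs => rw [hw]
    rw [sumElim_dotProduct, zero_mulVec, dotProduct_zero, add_zero]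
  have hSt : p ⬝ᵥ (blockS B P)ᵀ *ᵥ w = w ⬝ᵥ blockS B P *ᵥ p := by
    rw [dotProduct_mulVec, vecMul_transpose, dotProduct_comm]
  rw [sdpMatrix, fromBlocks_mulVec, Sum.elim_comp_inl, Sum.elim_comp_inr, sumElim_dotProduct,
    dotProduct_add, dotProduct_add, hO, hSt, hS, neg_mulVec, smul_mulVec, one_mulVec,
    dotProduct_neg, dotProduct_smul, smul_eq_mul]
  ring

lemma isSymm_sdpMatrix {P : Matrix (Fin n) (Fin n) ℝ} (hP : P.IsSymm)
    (lam : Fin m → Fin n → ℝ) (γ : ℝ) : (sdpMatrix A B lo hi P lam γ).IsSymm := by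
  have hO : (blockO A B lo hi P lam γ)ᵀ = blockO A B lo hi P lam γ := by
    simp only [blockO, transpose_add, transpose_smul, fromBlocks_transpose, transpose_mul,
      transpose_transpose, transpose_one, transpose_zero, hP.eq, (isSymm_M lam lo hi).eq,
      Matrix.mul_assoc, add_comm]
  rw [IsSymm, sdpMatrix, fromBlocks_transpose, hO, transpose_transpose, transpose_neg,
    transpose_smul, transpose_one]

lemma negDef_iff {ι : Type*} [Fintype ι] {X : Matrix ι ι ℝ} (hX : X.IsSymm) :
    NegDef X ↔ ∀ z, z ≠ 0 → z ⬝ᵥ X *ᵥ z < 0 := by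
  constructor
  · intro h z hz
    have := h.dotProduct_mulVec_pos hz
    simp only [star_trivial, neg_mulVec, dotProduct_neg] at this
    linarith
  · intro h
    refine PosDef.of_dotProduct_mulVec_pos ?_ fun z hz => ?_
    · rw [IsHermitian, conjTranspose_eq_transpose_of_trivial, transpose_neg, hX.eq]
    · simp only [star_trivial, neg_mulVec, dotProduct_neg]
      linarith [h z hz]

/-- Restriction to p = 0; the 1/γ term is nonnegative and can be dropped. -/
lemma storageIneq_of_negDef {P : Matrix (Fin n) (Fin n) ℝ} (hP : P.IsSymm)
    {lam : Fin m → Fin n → ℝ} {γ : ℝ} (hγ : 0 < γ) (h : NegDef (sdpMatrix A B lo hi P lam γ)) :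
    StorageIneq A B lo hi P lam := by
  intro w hw
  have hz : (Sum.elim w (0 : Fin m → ℝ)) ≠ 0 := fun h0 => hw (funext fun k =>
    congrFun h0 (Sum.inl k))
  have h1 := (negDef_iff (isSymm_sdpMatrix hP lam γ)).mp h _ hz
  rw [quadratic_sdpMatrix hP, mulVec_zero, dotProduct_zero, dotProduct_zero] at h1
  have h2 : 0 ≤ 1 / γ * ((w ∘ Sum.inl) ⬝ᵥ (w ∘ Sum.inl)) :=
    mul_nonneg (by positivity) (dotProduct_self_nonneg_real _)
  linarith

lemma StorageIneq.exists_negDef {P : Matrix (Fin n) (Fin n) ℝ} (hP : P.IsSymm)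
    {lam : Fin m → Fin n → ℝ} (h : StorageIneq A B lo hi P lam) :
    ∃ γ : ℝ, 0 < γ ∧ NegDef (sdpMatrix A B lo hi P lam γ) := by
  obtain ⟨ε, hε, hb⟩ := h.exists_bound hP
  obtain ⟨C, hC0, hC⟩ := exists_bilinear_bound (P * B)
  -- 4/ε bounds 1/γ by ε/4, 16C/ε pays for 2xᵀPBp at a cost of ε/4 in |x|², and 1 leaves a strict
  -- margin in p.
  set γ := 4 / ε + 16 * C / ε + 1 with hγ
  have hγ0 : 0 < γ := by positivity
  refine ⟨γ, hγ0, (negDef_iff (isSymm_sdpMatrix hP lam γ)).mpr fun z hz => ?_⟩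
  set w := z ∘ Sum.inl with hw
  set p := z ∘ Sum.inr with hp
  have hzw : z = Sum.elim w p := by ext k; cases k <;> rfl
  rw [hzw, quadratic_sdpMatrix hP]
  have h1 := hb w
  have h2 := (abs_le.mp (hC (ε / 8) (by positivity) (w ∘ Sum.inl) p)).2
  have hxw : (w ∘ Sum.inl) ⬝ᵥ (w ∘ Sum.inl) ≤ w ⬝ᵥ w := by
    have e : w = Sum.elim (w ∘ Sum.inl) (w ∘ Sum.inr) := by ext k; cases k <;> rfl
    have : w ⬝ᵥ w = (w ∘ Sum.inl) ⬝ᵥ (w ∘ Sum.inl) + (w ∘ Sum.inr) ⬝ᵥ (w ∘ Sum.inr) := by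
      conv_lhs => rw [e]
      rw [sumElim_dotProduct]
    linarith [dotProduct_self_nonneg_real (w ∘ Sum.inr)]
  have hx0 := dotProduct_self_nonneg_real (w ∘ Sum.inl)
  have hp0 := dotProduct_self_nonneg_real p
  have hw0 := dotProduct_self_nonneg_real w
  have hγinv : 1 / γ ≤ ε / 4 := by
    rw [div_le_iff₀ hγ0, hγ]
    have : ε / 4 * (4 / ε + 16 * C / ε + 1) = 1 + 4 * C + ε / 4 := by field_simp; ring
    rw [this]
    linarith
  have hCε : C / (ε / 8) = 8 * C / ε := by field_simp
  rw [hCε] at h2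
  have h3 : 0 < w ⬝ᵥ w + p ⬝ᵥ p := by
    have := dotProduct_self_pos_real hz
    rwa [hzw, sumElim_dotProduct] at this
  have h4 := mul_le_mul_of_nonneg_right hγinv hx0
  have h5 := mul_le_mul_of_nonneg_left hxw hε.le
  have h6 : γ * (p ⬝ᵥ p) = 4 / ε * (p ⬝ᵥ p) + 2 * (8 * C / ε * (p ⬝ᵥ p)) + p ⬝ᵥ p := by
    rw [hγ]; ring
  have h7 : 0 ≤ 4 / ε * (p ⬝ᵥ p) := by positivity
  rcases hw0.eq_or_lt with h0 | hpos
  · rw [← h0] at h1 h3 h5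
    nlinarith
  · have := mul_pos hε hpos
    nlinarith

/-- The storage inequality implies the multiplier condition. -/
lemma StorageIneq.multiplierCond (hA : IsHurwitz A) {P : Matrix (Fin n) (Fin n) ℝ} (hP : P.IsSymm)
    {lam : Fin m → Fin n → ℝ} (h : StorageIneq A B lo hi P lam) :
    MultiplierCond A B lo hi lam := by
  obtain ⟨ε, hε, hb⟩ := h.exists_bound hP
  refine ⟨ε, hε, fun q hq => ?_⟩
  rw [sum_phi_eq_integral lam lo hi (isL2_G hA hq) hq, sigNormSq_eq_integral hq]
  refine (isTrajectory_G hq).integral_le_of_dissipation hA hP (fun x u => ?_) hq (by simp [G])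
  have h1 := hb (Sum.elim x u)
  rw [Sum.elim_comp_inl, Sum.elim_comp_inr, sumElim_dotProduct] at h1
  have := mul_nonneg hε.le (dotProduct_self_nonneg_real x)
  linarith

/-- The multiplier condition implies the frequency domain inequality in real coordinates. -/
lemma MultiplierCond.freqNeg (hA : IsHurwitz A) {lam : Fin m → Fin n → ℝ}
    (h : MultiplierCond A B lo hi lam) :
    ∃ ε : ℝ, 0 < ε ∧ FreqNeg A (B * W m n) (M lam lo hi) ε := by
  obtain ⟨ε, hε, hq⟩ := h
  refine ⟨ε, hε, fun ω x₁ x₂ v₁ v₂ h₁ h₂ => ?_⟩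
  -- Putting ε|q|² into the form reduces the strict inequality to the nonstrict transfer lemma with
  -- the same ε.
  set E : Matrix (Fin n ⊕ (Fin m × Fin n)) (Fin n ⊕ (Fin m × Fin n)) ℝ :=
    fromBlocks 0 0 0 (ε • 1) with hE
  have hEq : ∀ (x : Fin n → ℝ) (u : Fin m × Fin n → ℝ),
      Sum.elim x u ⬝ᵥ (M lam lo hi + E) *ᵥ Sum.elim x u
        = Sum.elim x u ⬝ᵥ M lam lo hi *ᵥ Sum.elim x u + ε * (u ⬝ᵥ u) := by
    intro x u
    rw [add_mulVec, dotProduct_add, hE, fromBlocks_mulVec, Sum.elim_comp_inl, Sum.elim_comp_inr,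
      sumElim_dotProduct]
    simp [smul_mulVec]
  have hS : (M lam lo hi + E).IsSymm := by
    rw [IsSymm, transpose_add, (isSymm_M lam lo hi).eq, hE, fromBlocks_transpose]
    simp
  have key := freq_le_of_time_le hA hS (b := B * W m n) (fun q x hqL hx => ?_) h₁ h₂
  · rw [hEq, hEq] at key
    linarith
  · have hx' : x = G A B q := hx
    have hxL : IsL2 x := by rw [hx']; exact isL2_G hA hqL
    have hw := hxL.sumElim hqL
    simp only [hEq]
    rw [integral_add (hw.integrable_dotProduct (hw.mulVec _))
      ((hqL.integrable_dotProduct hqL).const_mul ε), integral_const_mul,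
      ← sum_phi_eq_integral lam lo hi hxL hqL, ← sigNormSq_eq_integral hqL, hx']
    linarith [hq q hqL]

lemma exists_storageIneq (hA : IsHurwitz A) {lam : Fin m → Fin n → ℝ} {ε : ℝ} (hε : 0 < ε)
    (h : FreqNeg A (B * W m n) (M lam lo hi) ε) :
    ∃ P : Matrix (Fin n) (Fin n) ℝ, P.IsSymm ∧ StorageIneq A B lo hi P lam :=
  h.exists_storage hA (isSymm_M lam lo hi) hε

/-- At q = 0 the multiplier form is nonnegative, so the storage inequality leaves xᵀPAx ≤ 0. -/
lemma StorageIneq.posSemidef (hA : IsHurwitz A) {P : Matrix (Fin n) (Fin n) ℝ} (hP : P.IsSymm)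
    {lam : Fin m → Fin n → ℝ} (hlam : ∀ i j, 0 ≤ lam i j)
    (hc : ∀ i j, center lo hi i j ^ 2 ≤ radius lo hi i j ^ 2)
    (h : StorageIneq A B lo hi P lam) : P.PosSemidef := by
  refine hA.posSemidef_of_lyapunov hP fun x => ?_
  by_cases hx : x = 0
  · simp [hx]
  have hw : Sum.elim x (0 : Fin m × Fin n → ℝ) ≠ 0 := fun h0 => hx (funext fun k =>
    congrFun h0 (Sum.inl k))
  have h1 := h _ hw
  rw [Sum.elim_comp_inl, Sum.elim_comp_inr, mulVec_zero, add_zero, quadratic_M] at h1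
  have h2 : 0 ≤ ∑ i, ∑ j, lam i j * ((radius lo hi i j ^ 2 - center lo hi i j ^ 2) * (x j * x j)
      + 2 * center lo hi i j * ((0 : Fin m × Fin n → ℝ) (i, j) * x j)
      - (0 : Fin m × Fin n → ℝ) (i, j) * (0 : Fin m × Fin n → ℝ) (i, j)) := by
    refine Finset.sum_nonneg fun i _ => Finset.sum_nonneg fun j _ => mul_nonneg (hlam i j) ?_
    have := mul_nonneg (sub_nonneg.mpr (hc i j)) (mul_self_nonneg (x j))
    simpa using this
  linarith

lemma star_dotProduct_freqForm (lam : Fin m → Fin n → ℝ) (ω : ℝ) (v : Fin m × Fin n → ℂ) :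
    star v ⬝ᵥ freqForm A B lo hi lam ω *ᵥ v
      = star (Sum.elim (Ghat A B ω *ᵥ v) v) ⬝ᵥ
        (M lam lo hi).map Complex.ofReal *ᵥ Sum.elim (Ghat A B ω *ᵥ v) v := by
  have e : fromRows (Ghat A B ω) (1 : Matrix (Fin m × Fin n) (Fin m × Fin n) ℂ) *ᵥ v
      = Sum.elim (Ghat A B ω *ᵥ v) v := by rw [fromRows_mulVec, one_mulVec]
  rw [freqForm, ← mulVec_mulVec, ← mulVec_mulVec, e, dotProduct_mulVec, ← star_mulVec, e]

lemma isHermitian_freqForm (lam : Fin m → Fin n → ℝ) (ω : ℝ) :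
    (freqForm A B lo hi lam ω).IsHermitian := by
  have hM : ((M lam lo hi).map Complex.ofReal)ᴴ = (M lam lo hi).map Complex.ofReal := by
    ext i j
    simp only [conjTranspose_apply, Matrix.map_apply, Complex.star_def, Complex.conj_ofReal]
    rw [← (isSymm_M lam lo hi).apply]
  rw [IsHermitian, freqForm, conjTranspose_mul, conjTranspose_mul, conjTranspose_conjTranspose, hM,
    Matrix.mul_assoc]

/-- Real coordinates of the frequency response. -/
lemma Ghat_mulVec_eq_iff (hA : IsHurwitz A) (ω : ℝ) (x : Fin n → ℂ) (v : Fin m × Fin n → ℂ) :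
    Ghat A B ω *ᵥ v = x ↔
      A *ᵥ reVec x + (B * W m n) *ᵥ reVec v = -ω • imVec x ∧
      A *ᵥ imVec x + (B * W m n) *ᵥ imVec v = ω • reVec x := by
  have hu := (Matrix.isUnit_iff_isUnit_det _).mp (hA.isUnit_sub (s := Complex.I * ω) (by simp))
  set R := (Complex.I * (ω : ℂ)) • (1 : Matrix (Fin n) (Fin n) ℂ) - A.map Complex.ofReal with hR
  set g := (B * W m n).map Complex.ofReal *ᵥ v with hg
  have h1 : Ghat A B ω *ᵥ v = x ↔ g = R *ᵥ x := by
    rw [Ghat, ← mulVec_mulVec, ← hR, ← hg]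
    constructor
    · rintro rfl
      rw [mulVec_mulVec, mul_nonsing_inv _ hu, one_mulVec]
    · intro h
      rw [h, mulVec_mulVec, nonsing_inv_mul _ hu, one_mulVec]
  have h2 : g = R *ᵥ x ↔ A.map Complex.ofReal *ᵥ x + g = (Complex.I * (ω : ℂ)) • x := by
    rw [hR, sub_mulVec, smul_mulVec, one_mulVec, eq_sub_iff_add_eq, add_comm]
  have h3 : ∀ y z : Fin n → ℂ, y = z ↔ reVec y = reVec z ∧ imVec y = imVec z := fun y z =>
    ⟨fun h => by rw [h]; exact ⟨rfl, rfl⟩, fun h => funext fun i =>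
      Complex.ext (congrFun h.1 i) (congrFun h.2 i)⟩
  have e1 : reVec (A.map Complex.ofReal *ᵥ x + g) = A *ᵥ reVec x + (B * W m n) *ᵥ reVec v := by
    rw [← reVec_mulVec, ← reVec_mulVec]; rfl
  have e2 : imVec (A.map Complex.ofReal *ᵥ x + g) = A *ᵥ imVec x + (B * W m n) *ᵥ imVec v := by
    rw [← imVec_mulVec, ← imVec_mulVec]; rfl
  have e3 : reVec ((Complex.I * (ω : ℂ)) • x) = -ω • imVec x := by
    ext i; simp [reVec, imVec]
  have e4 : imVec ((Complex.I * (ω : ℂ)) • x) = ω • reVec x := by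
    ext i; simp [reVec, imVec]
  rw [h1, h2, h3, e1, e2, e3, e4]

lemma re_quadratic_freqForm (lam : Fin m → Fin n → ℝ) (ω : ℝ) (v : Fin m × Fin n → ℂ) :
    (star v ⬝ᵥ freqForm A B lo hi lam ω *ᵥ v).re
      = Sum.elim (reVec (Ghat A B ω *ᵥ v)) (reVec v) ⬝ᵥ
          M lam lo hi *ᵥ Sum.elim (reVec (Ghat A B ω *ᵥ v)) (reVec v)
        + Sum.elim (imVec (Ghat A B ω *ᵥ v)) (imVec v) ⬝ᵥ
          M lam lo hi *ᵥ Sum.elim (imVec (Ghat A B ω *ᵥ v)) (imVec v) := by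
  rw [star_dotProduct_freqForm, re_star_dotProduct_mulVec]
  have e1 : ∀ x : Fin n → ℂ, reVec (Sum.elim x v) = Sum.elim (reVec x) (reVec v) := fun x => by
    ext k; cases k <;> rfl
  have e2 : ∀ x : Fin n → ℂ, imVec (Sum.elim x v) = Sum.elim (imVec x) (imVec v) := fun x => by
    ext k; cases k <;> rfl
  rw [e1, e2]

lemma re_quadratic_shift (lam : Fin m → Fin n → ℝ) (ω ε : ℝ) (v : Fin m × Fin n → ℂ) :
    (star v ⬝ᵥ (-((ε : ℂ) • (1 : Matrix (Fin m × Fin n) (Fin m × Fin n) ℂ))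
      - freqForm A B lo hi lam ω) *ᵥ v).re
      = -ε * (reVec v ⬝ᵥ reVec v + imVec v ⬝ᵥ imVec v)
        - (star v ⬝ᵥ freqForm A B lo hi lam ω *ᵥ v).re := by
  rw [sub_mulVec, dotProduct_sub, Complex.sub_re, neg_mulVec, smul_mulVec, one_mulVec,
    dotProduct_neg, dotProduct_smul, smul_eq_mul, Complex.neg_re, Complex.re_ofReal_mul,
    re_star_dotProduct, neg_mul]

/-- The same ε works on both sides: the complex form at (Ĝv, v) is the sum of the real forms at its
real and imaginary parts. -/
lemma freqCond_iff (hA : IsHurwitz A) (lam : Fin m → Fin n → ℝ) :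
    FreqCond A B lo hi lam ↔
      ∃ ε : ℝ, 0 < ε ∧ FreqNeg A (B * W m n) (M lam lo hi) ε := by
  refine exists_congr fun ε => and_congr_right fun _ => ⟨fun h => ?_, fun h ω => ?_⟩
  · intro ω x₁ x₂ v₁ v₂ h₁ h₂
    set x : Fin n → ℂ := fun i => ⟨x₁ i, x₂ i⟩ with hx
    set v : Fin m × Fin n → ℂ := fun i => ⟨v₁ i, v₂ i⟩ with hv
    have hG : Ghat A B ω *ᵥ v = x := (Ghat_mulVec_eq_iff hA ω x v).mpr ⟨h₁, h₂⟩
    have h3 := (Complex.le_def.mp ((h ω).dotProduct_mulVec_nonneg v)).1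
    rw [re_quadratic_shift, re_quadratic_freqForm, hG, Complex.zero_re] at h3
    have h4 : Sum.elim x₁ v₁ ⬝ᵥ M lam lo hi *ᵥ Sum.elim x₁ v₁
        + Sum.elim x₂ v₂ ⬝ᵥ M lam lo hi *ᵥ Sum.elim x₂ v₂
        = Sum.elim (reVec x) (reVec v) ⬝ᵥ M lam lo hi *ᵥ Sum.elim (reVec x) (reVec v)
        + Sum.elim (imVec x) (imVec v) ⬝ᵥ M lam lo hi *ᵥ Sum.elim (imVec x) (imVec v) := rfl
    have h5 : v₁ ⬝ᵥ v₁ + v₂ ⬝ᵥ v₂ = reVec v ⬝ᵥ reVec v + imVec v ⬝ᵥ imVec v := rfl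
    rw [h4, h5]
    linarith
  · have hH : (-((ε : ℂ) • (1 : Matrix (Fin m × Fin n) (Fin m × Fin n) ℂ))
        - freqForm A B lo hi lam ω).IsHermitian := by
      refine IsHermitian.sub (IsHermitian.neg ?_) (isHermitian_freqForm lam ω)
      rw [IsHermitian, conjTranspose_smul, conjTranspose_one, Complex.star_def, Complex.conj_ofReal]
    refine PosSemidef.of_dotProduct_mulVec_nonneg hH fun v => Complex.le_def.mpr ⟨?_, ?_⟩
    · obtain ⟨h₁, h₂⟩ := (Ghat_mulVec_eq_iff hA ω _ v).mp rfl
      have := h ω _ _ _ _ h₁ h₂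
      rw [re_quadratic_shift, re_quadratic_freqForm, Complex.zero_re]
      linarith
    · exact (hH.im_star_dotProduct_mulVec_self v).symm

end Equivalences

end SmoothMargin

theorem mainTheorem5 (n m : ℕ) (A : Matrix (Fin n) (Fin n) ℝ) (B : Matrix (Fin n) (Fin m) ℝ)
    (hA : SmoothMargin.IsHurwitz A) (lo hi : Fin m → Fin n → ℝ) :
    -- `x = G q` is square integrable whenever `q` is
    (∀ q : ℝ → Fin m × Fin n → ℝ, SmoothMargin.IsL2 q →
      SmoothMargin.IsL2 (SmoothMargin.G A B q)) ∧
    -- the SDP (with `P` positive semidefinite) and the multiplier condition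
    ((∀ i j, (SmoothMargin.center lo hi i j) ^ 2 ≤ (SmoothMargin.radius lo hi i j) ^ 2) →
      ((∃ (P : Matrix (Fin n) (Fin n) ℝ) (lam : Fin m → Fin n → ℝ) (γ : ℝ),
          P.PosSemidef ∧ (∀ i j, 0 ≤ lam i j) ∧ 0 < γ ∧
          SmoothMargin.NegDef (SmoothMargin.sdpMatrix A B lo hi P lam γ)) ↔
        ∃ lam : Fin m → Fin n → ℝ, (∀ i j, 0 ≤ lam i j) ∧
          SmoothMargin.MultiplierCond A B lo hi lam)) ∧
    -- the same for arbitrary bounds, with `P` symmetric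
    ((∃ (P : Matrix (Fin n) (Fin n) ℝ) (lam : Fin m → Fin n → ℝ) (γ : ℝ),
        P.IsSymm ∧ (∀ i j, 0 ≤ lam i j) ∧ 0 < γ ∧
        SmoothMargin.NegDef (SmoothMargin.sdpMatrix A B lo hi P lam γ)) ↔
      ∃ lam : Fin m → Fin n → ℝ, (∀ i j, 0 ≤ lam i j) ∧
        SmoothMargin.MultiplierCond A B lo hi lam) ∧
    -- for given multipliers, the multiplier condition and the frequency-domain inequality
    (∀ lam : Fin m → Fin n → ℝ, (∀ i j, 0 ≤ lam i j) →
      (SmoothMargin.MultiplierCond A B lo hi lam ↔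
        SmoothMargin.FreqCond A B lo hi lam)) := by
  refine ⟨fun q hq => SmoothMargin.isL2_G hA hq, fun hc => ⟨?_, ?_⟩, ⟨?_, ?_⟩, fun lam _ => ⟨?_, ?_⟩⟩
  · rintro ⟨P, lam, γ, hP, hlam, hγ, h⟩
    have hPs : P.IsSymm := by simpa [IsHermitian, IsSymm] using hP.isHermitian
    exact ⟨lam, hlam, (SmoothMargin.storageIneq_of_negDef hPs hγ h).multiplierCond hA hPs⟩
  · rintro ⟨lam, hlam, h⟩
    obtain ⟨ε, hε, hF⟩ := h.freqNeg hA
    obtain ⟨P, hPs, hP⟩ := SmoothMargin.exists_storageIneq hA hε hF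
    obtain ⟨γ, hγ, hS⟩ := hP.exists_negDef hPs
    exact ⟨P, lam, γ, hP.posSemidef hA hPs hlam hc, hlam, hγ, hS⟩
  · rintro ⟨P, lam, γ, hPs, hlam, hγ, h⟩
    exact ⟨lam, hlam, (SmoothMargin.storageIneq_of_negDef hPs hγ h).multiplierCond hA hPs⟩
  · rintro ⟨lam, hlam, h⟩
    obtain ⟨ε, hε, hF⟩ := h.freqNeg hA
    obtain ⟨P, hPs, hP⟩ := SmoothMargin.exists_storageIneq hA hε hF
    obtain ⟨γ, hγ, hS⟩ := hP.exists_negDef hPs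
    exact ⟨P, lam, γ, hPs, hlam, hγ, hS⟩
  · intro h
    exact (SmoothMargin.freqCond_iff hA lam).mpr (h.freqNeg hA)
  -- The return to the time domain passes through a storage matrix, so no Fourier transform or
  -- Parseval identity is needed.
  · intro h
    obtain ⟨ε, hε, hF⟩ := (SmoothMargin.freqCond_iff hA lam).mp h
    obtain ⟨P, hPs, hP⟩ := SmoothMargin.exists_storageIneq hA hε hF
    exact hP.multiplierCond hA hPs
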